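/- For a nonempty integer partition $\pi$, let $\operatorname{maex}(\pi)$ denote the largest nonnegative integer that is smaller than the largest part of $\pi$ and is not a part of $\pi$, and let $\sigma\!\operatorname{maex}(n)=\sum_{\pi\vdash n}\operatorname{maex}(\pi)$, the sum running over all partitions of $n$. Let $p(n)$ be the number of partitions of $n$ (with $p(0)=1$) and $d(n)$ the number of positive divisors of $n$. Call two integer solutions $(u,v)$ and $(u',v')$ of $u^2-6v^2=m$ equivalent if $u'+v'\sqrt6=\pm(5+2\sqrt6)^r(u+v\sqrt6)$ for some $r\in\mathbb{Z}$. For an integer $m\equiv 1\pmod 6$, let $T(m)$ be the excess of the number of inequivalent solutions of the Pell equation $u^2-6v^2=m$ with $u+3v\equiv\pm1\pmod{12}$ over the number of inequivalent solutions with $u+3v\equiv\pm5\pmod{12}$. (For such $m$ there are finitely many classes, and each of these two congruence conditions depends only on the class of the solution.) Theorem. For every integer $n\ge 1$, $$\sigma\!\operatorname{maex}(n)=\sum_{k=1}^n p(n-k)\left(d(k)+\tfrac12\,T(1-24k)\right).$$ -/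

import Mathlib

/-! ### Maximal excludants of partitions -/

/-- The largest part of a partition (`0` for the empty partition). -/
def largestPart {n : ℕ} (π : n.Partition) : ℕ :=
  π.parts.toFinset.sup id

/-- The maximal excludant: the largest nonnegative integer that is smaller than the largest part
and is not a part. For a nonempty partition the set below is nonempty, as it contains `0`. -/
def maex {n : ℕ} (π : n.Partition) : ℕ :=
  ((Finset.range (largestPart π)).filter fun j => j ∉ π.parts).sup id

/-- The sum of the maximal excludants over all partitions of `n`. -/
def sigmaMaex (n : ℕ) : ℕ :=
  ∑ π : n.Partition, maex π

/-- The number `p(n)` of partitions of `n`. -/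
def numPartitions (n : ℕ) : ℕ :=
  Fintype.card n.Partition

/-- For a nonempty partition, `maex` is the greatest element of the set that defines it. -/
theorem isGreatest_maex {n : ℕ} (hn : 1 ≤ n) (π : n.Partition) :
    IsGreatest {j : ℕ | j < largestPart π ∧ j ∉ π.parts} (maex π) := by
  have hpos : 0 < largestPart π := by
    have hne : π.parts ≠ 0 := by
      intro h
      have h2 := π.parts_sum
      rw [h] at h2
      simp at h2
      omega
    obtain ⟨a, ha⟩ := Multiset.exists_mem_of_ne_zero hne
    exact lt_of_lt_of_le (π.parts_pos ha)
      (Finset.le_sup (f := id) (Multiset.mem_toFinset.mpr ha))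
  have h0 : 0 ∈ (Finset.range (largestPart π)).filter fun j => j ∉ π.parts := by
    simp only [Finset.mem_filter, Finset.mem_range]
    exact ⟨hpos, fun h => absurd (π.parts_pos h) (lt_irrefl 0)⟩
  constructor
  · obtain ⟨j, hj, hj2⟩ := Finset.exists_mem_eq_sup _ ⟨0, h0⟩ (id : ℕ → ℕ)
    have h3 : maex π = j := hj2
    rw [h3]
    simpa using hj
  · rintro j ⟨h1, h2⟩
    exact Finset.le_sup (f := id) (by simp [h1, h2])

/-! ### The Pell equation `u ^ 2 - 6 * v ^ 2 = m` -/

/-- The unit `5 + 2√6` of `ℤ[√6]`, with inverse `5 - 2√6`. -/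
def pellUnit : (ℤ√6)ˣ where
  val := ⟨5, 2⟩
  inv := ⟨5, -2⟩
  val_inv := by decide
  inv_val := by decide

/-- The integer solutions of `u ^ 2 - 6 * v ^ 2 = m`; the pair `(u, v)` is written `u + v√6`. -/
abbrev PellSol (m : ℤ) : Type :=
  {x : ℤ√6 // x.re ^ 2 - 6 * x.im ^ 2 = m}

/-- Two solutions are equivalent if `u' + v'√6 = ±(5 + 2√6) ^ r * (u + v√6)`
for some integer `r`. -/
def PellEquiv {m : ℤ} (x y : PellSol m) : Prop :=
  ∃ r : ℤ, y.1 = ((pellUnit ^ r : (ℤ√6)ˣ) : ℤ√6) * x.1 ∨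
    y.1 = -(((pellUnit ^ r : (ℤ√6)ˣ) : ℤ√6) * x.1)

theorem pellEquiv_equivalence (m : ℤ) : Equivalence (@PellEquiv m) where
  refl x := ⟨0, Or.inl (by simp)⟩
  symm := by
    rintro x y ⟨r, h | h⟩
    · exact ⟨-r, Or.inl (by rw [h, ← mul_assoc, ← Units.val_mul, ← zpow_add]; simp)⟩
    · exact ⟨-r, Or.inr (by rw [h, mul_neg, ← mul_assoc, ← Units.val_mul, ← zpow_add]; simp)⟩
  trans := by
    rintro x y z ⟨r, h | h⟩ ⟨s, h' | h'⟩
    · exact ⟨s + r, Or.inl (by rw [h', h, zpow_add, Units.val_mul, mul_assoc])⟩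
    · exact ⟨s + r, Or.inr (by rw [h', h, zpow_add, Units.val_mul, mul_assoc])⟩
    · exact ⟨s + r, Or.inr (by rw [h', h, zpow_add, Units.val_mul, mul_assoc, mul_neg])⟩
    · exact ⟨s + r, Or.inl (by rw [h', h, zpow_add, Units.val_mul, mul_assoc, mul_neg, neg_neg])⟩

/-- The equivalence of solutions, as a setoid. -/
def pellSetoid (m : ℤ) : Setoid (PellSol m) :=
  ⟨PellEquiv, pellEquiv_equivalence m⟩

/-- The number of inequivalent solutions `(u, v)` with `u + 3 * v ≡ ±a (mod 12)`: the number of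
equivalence classes that contain such a solution. -/
noncomputable def pellCount (m a : ℤ) : ℕ :=
  Set.ncard {c : Quotient (pellSetoid m) | ∃ x : PellSol m, Quotient.mk (pellSetoid m) x = c ∧
    (x.1.re + 3 * x.1.im ≡ a [ZMOD 12] ∨ x.1.re + 3 * x.1.im ≡ -a [ZMOD 12])}

/-- `T(m)`, for `m ≡ 1 (mod 6)`: the excess of the number of inequivalent solutions of
`u ^ 2 - 6 * v ^ 2 = m` with `u + 3 * v ≡ ±1 (mod 12)` over the number of those with
`u + 3 * v ≡ ±5 (mod 12)`. -/
noncomputable def pellT (m : ℤ) : ℤ :=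
  (pellCount m 1 : ℤ) - (pellCount m 5 : ℤ)

/-- For odd `m` the residue of `u + 3 * v` modulo `12` up to sign, if it is `±1` or `±5`, depends
only on the class of the solution, so that each class is counted at most once in `pellT`. -/
theorem pellEquiv_residue {m a : ℤ} (hm : Odd m) (ha : a = 1 ∨ a = 5) {x y : PellSol m}
    (h : PellEquiv x y)
    (hx : x.1.re + 3 * x.1.im ≡ a [ZMOD 12] ∨ x.1.re + 3 * x.1.im ≡ -a [ZMOD 12]) :
    y.1.re + 3 * y.1.im ≡ a [ZMOD 12] ∨ y.1.re + 3 * y.1.im ≡ -a [ZMOD 12] := by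
  have hodd : x.1.re % 2 = 1 := by
    have h1 : x.1.re ^ 2 - 6 * x.1.im ^ 2 = m := x.2
    by_contra h2
    have h3 : x.1.re % 2 = 0 := by omega
    obtain ⟨k, hk⟩ : ∃ k, x.1.re = 2 * k := ⟨x.1.re / 2, by omega⟩
    obtain ⟨l, hl⟩ := hm
    rw [hk] at h1
    have : 2 * (2 * k ^ 2 - 3 * x.1.im ^ 2 - l) = 1 := by linarith
    omega
  have heven : x.1.im % 2 = 0 := by
    simp only [Int.ModEq] at hx
    rcases ha with rfl | rfl <;> omega
  let P : ℤ√6 → Prop := fun w => w.im % 2 = 0 ∧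
    (w.re + 3 * w.im ≡ a [ZMOD 12] ∨ w.re + 3 * w.im ≡ -a [ZMOD 12])
  have key : ∀ (r : ℤ) (w : ℤ√6), P w → P (((pellUnit ^ r : (ℤ√6)ˣ) : ℤ√6) * w) := by
    intro r
    induction r using Int.induction_on with
    | zero => intro w hw; simpa using hw
    | succ i ih =>
      intro w hw
      rw [zpow_add_one, Units.val_mul, mul_assoc]
      apply ih
      obtain ⟨h1, h2⟩ := hw
      simp only [P, pellUnit, Zsqrtd.re_mul, Zsqrtd.im_mul, Int.ModEq] at h2 ⊢
      refine ⟨by omega, ?_⟩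
      rcases ha with rfl | rfl <;> omega
    | pred i ih =>
      intro w hw
      rw [zpow_sub_one, Units.val_mul, mul_assoc]
      apply ih
      obtain ⟨h1, h2⟩ := hw
      simp only [P, pellUnit, Units.inv_mk, Zsqrtd.re_mul, Zsqrtd.im_mul, Int.ModEq] at h2 ⊢
      refine ⟨by omega, ?_⟩
      rcases ha with rfl | rfl <;> omega
  obtain ⟨r, h | h⟩ := h
  · rw [h]
    exact (key r x.1 ⟨heven, hx⟩).2
  · have h2 := (key r x.1 ⟨heven, hx⟩).2
    rw [h]
    simp only [Zsqrtd.re_neg, Zsqrtd.im_neg, Int.ModEq] at h2 ⊢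
    rcases ha with rfl | rfl <;> omega

theorem pellUnit_generates {x : ℤ√6} (hx : x.re ^ 2 - 6 * x.im ^ 2 = 1) :
    ∃ r : ℤ, x = ((pellUnit ^ r : (ℤ√6)ˣ) : ℤ√6) ∨ x = -((pellUnit ^ r : (ℤ√6)ˣ) : ℤ√6) := by
  let e : Pell.Solution₁ 6 := Pell.Solution₁.mk 5 2 (by norm_num)
  have he : Pell.IsFundamental e := by
    refine ⟨by simp [e], by simp [e], ?_⟩
    intro b hb
    have h1 := b.prop
    simp only [e, Pell.Solution₁.x_mk]
    by_contra h2
    have h3 : b.x < 5 := by omega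
    have h4 : b.x = 2 ∨ b.x = 3 ∨ b.x = 4 := by omega
    rcases h4 with h4 | h4 | h4 <;> rw [h4] at h1 <;> omega
  have hz : ∀ r : ℤ, ((e ^ r : Pell.Solution₁ 6) : ℤ√6) = ((pellUnit ^ r : (ℤ√6)ˣ) : ℤ√6) := by
    intro r
    induction r using Int.induction_on with
    | zero => rfl
    | succ i ih => rw [zpow_add_one, zpow_add_one, Units.val_mul, ← ih]; rfl
    | pred i ih => rw [zpow_sub_one, zpow_sub_one, Units.val_mul, ← ih]; rfl
  obtain ⟨r, h⟩ := he.eq_zpow_or_neg_zpow (Pell.Solution₁.mk x.re x.im hx)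
  have hxe : x = ((Pell.Solution₁.mk x.re x.im hx : Pell.Solution₁ 6) : ℤ√6) := by
    ext <;> rfl
  refine ⟨r, ?_⟩
  rw [hxe, ← hz r]
  rcases h with h | h
  · exact Or.inl (by rw [h])
  · exact Or.inr (by rw [h]; rfl)

/-- For `m ≠ 0` there are only finitely many inequivalent solutions, so that the cardinalities in
`pellCount` are cardinalities of finite sets. -/
theorem finite_pell_classes {m : ℤ} (hm : m ≠ 0) : Finite (Quotient (pellSetoid m)) := by
  have : NeZero m.natAbs := ⟨by simpa using hm⟩
  let f : PellSol m → ZMod m.natAbs × ZMod m.natAbs := fun x => (x.1.re, x.1.im)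
  have hf : ∀ x y : PellSol m, f x = f y → PellEquiv x y := by
    intro x y hxy
    have h1 : ((x.1.re : ℤ) : ZMod m.natAbs) = y.1.re := congrArg Prod.fst hxy
    have h2 : ((x.1.im : ℤ) : ZMod m.natAbs) = y.1.im := congrArg Prod.snd hxy
    rw [ZMod.intCast_eq_intCast_iff_dvd_sub, Int.natCast_natAbs, abs_dvd] at h1 h2
    obtain ⟨s, hs⟩ := h1
    obtain ⟨t, ht⟩ := h2
    have hx := x.2
    have hy := y.2
    have hr : y.1.re = x.1.re + m * s := by linarith
    have hi : y.1.im = x.1.im + m * t := by linarith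
    let a : ℤ := 1 + s * x.1.re - 6 * t * x.1.im
    let b : ℤ := t * x.1.re - s * x.1.im
    have hre : y.1.re = a * x.1.re + 6 * b * x.1.im := by
      rw [hr]; simp only [a, b]; linear_combination (-s) * hx
    have him : y.1.im = a * x.1.im + b * x.1.re := by
      rw [hi]; simp only [a, b]; linear_combination (-t) * hx
    have hab : a ^ 2 - 6 * b ^ 2 = 1 := by
      rw [hre, him] at hy
      have : m * (a ^ 2 - 6 * b ^ 2) = m * 1 := by
        linear_combination hy - (a ^ 2 - 6 * b ^ 2) * hx
      exact mul_left_cancel₀ hm this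
    have hmul : y.1 = (⟨a, b⟩ : ℤ√6) * x.1 := by
      ext
      · simp only [Zsqrtd.re_mul]; rw [hre]
      · simp only [Zsqrtd.im_mul]; rw [him]
    obtain ⟨r, h | h⟩ := pellUnit_generates (x := ⟨a, b⟩) hab
    · exact ⟨r, Or.inl (by rw [hmul, h])⟩
    · exact ⟨r, Or.inr (by rw [hmul, h, neg_mul])⟩
  refine Finite.of_injective (fun c : Quotient (pellSetoid m) => f (Quotient.out c)) ?_
  intro c c' h
  rw [← Quotient.out_eq c, ← Quotient.out_eq c']
  exact Quotient.sound (hf _ _ h)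

/-!
Write `L` for the largest part of a partition. Then `L - maex` is the number of `a < L` for which
`a + 1, …, L` are all parts, so, with `B_L = ∑_{a < L} q ^ ((a + 1) + ⋯ + L)`,
`∑ σmaex(n) q ^ n = ∑_L (L q ^ L - B_L) / (q; q)_L` (`sigmaMaex_eq_coeff`).

Inserting `z ^ L` into the two sums and comparing the values at `z` and `q z` gives first order
functional equations. Iterating them extracts the generating function `P` of all partitions:
`∑ L q ^ L / (q; q)_L = P ∑ q ^ i / (1 - q ^ i)`, which accounts for the divisor function
(`sum_natCast_mul_eq`), and `∑ B_L / (q; q)_L = P F` with `F = ∑ q ^ (n + 1) (q²; q²)_n`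
(`sum_run_mul_eq`). It remains to show that the coefficient of `q ^ k` in `F` is
`-T(1 - 24 k) / 2`.

The Rogers–Fine identity turns `F` into `∑ (-1) ^ n q ^ ((n + 1) ^ 2) / (q; q²)_{n + 1}`
(`sum_evenPoch_eq`). An explicit Bailey pair in base `q²` (`bailey_pair`) and a conjugate Bailey
pair (`conjugate_bailey_pair`), both verified by telescoping, yield
`F = ∑_{s ≥ 1} (-1) ^ (s - 1) (q ^ (3 s² - s) + q ^ (3 s² + s)) ∑_{0 ≤ j < 2 s} q ^ (-j(j+1)/2)`
(`sum_evenPoch_eq_hecke`). With `x = 6 s ± 1` and `y = 2 j + 1` an exponent `k` of this sum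
satisfies `2 x² - 3 y² = 24 k - 1` and `3 y < 2 x`. The substitution `u = 2 x ± 3 y`, `v = x ± y`
maps each such pair to two solutions of `u² - 6 v² = 1 - 24 k`, and the solutions that arise are
those with `0 < u` and `5 u < 12 v`. These form a fundamental domain
for multiplication by `±(5 + 2√6) ^ r` (`pellCount_eq_ncard_reduced`), and the parity of `s` is
the residue condition (`pellT_eq_sum`).

The `q`-series are handled in a commutative ring in which `q ^ M = 0`, so that all sums are finite.
The reciprocals `1 / (q; q)_n` enter as sequences `e` with `e 0 = 1` and
`e n = (1 - q ^ (n + 1)) e (n + 1)`.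
-/

/-! ### Two functional equations for sums over the largest part -/

section QSeries

variable {A : Type*} [CommRing A] {q : A} {M : ℕ}

/-- Shifting the index in a sum against `1 / (q; q)_L`: the factor `1 - q ^ L` lowers the index of
the Pochhammer symbol. -/
theorem sum_one_sub_pow_mul {e : ℕ → A} (he : ∀ n, e n = (1 - q ^ (n + 1)) * e (n + 1))
    (g : ℕ → A) (hg : g M = 0) :
    ∑ L ∈ Finset.range M, g L * e L - ∑ L ∈ Finset.range M, q ^ L * g L * e L =
      ∑ L ∈ Finset.range M, g (L + 1) * e L := by
  have h1 : ∑ L ∈ Finset.range (M + 1), (1 - q ^ L) * g L * e L =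
      ∑ L ∈ Finset.range M, g (L + 1) * e L := by
    rw [Finset.sum_range_succ']
    simp only [pow_zero, sub_self, zero_mul, add_zero]
    refine Finset.sum_congr rfl fun L _ => ?_
    rw [he L]; ring
  rw [← h1, Finset.sum_range_succ, hg, ← Finset.sum_sub_distrib]
  simp only [mul_zero, zero_mul, add_zero]
  exact Finset.sum_congr rfl fun L _ => by ring

/-- Euler's sum `∑ q ^ (i * L) / (q; q)_L`, truncated at `L < M`; for `q ^ M = 0` it is
`1 / (q ^ i; q)_∞`, and for `i = 1` the generating function of all partitions. -/
def eulerSum (q : A) (M : ℕ) (e : ℕ → A) (i : ℕ) : A :=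
  ∑ L ∈ Finset.range M, q ^ (i * L) * e L

theorem eulerSum_succ (hq : q ^ M = 0) {e : ℕ → A}
    (he : ∀ n, e n = (1 - q ^ (n + 1)) * e (n + 1)) {i : ℕ} (hi : 1 ≤ i) :
    eulerSum q M e (i + 1) = (1 - q ^ i) * eulerSum q M e i := by
  have h := sum_one_sub_pow_mul (M := M) he (fun L => q ^ (i * L))
    (pow_eq_zero_of_le (Nat.le_mul_of_pos_left M hi) hq)
  have h2 : ∑ L ∈ Finset.range M, q ^ L * q ^ (i * L) * e L = eulerSum q M e (i + 1) :=
    Finset.sum_congr rfl fun L _ => by ring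
  have h3 : ∑ L ∈ Finset.range M, q ^ (i * (L + 1)) * e L = q ^ i * eulerSum q M e i := by
    rw [eulerSum, Finset.mul_sum]
    exact Finset.sum_congr rfl fun L _ => by ring
  rw [h2, h3] at h
  have h4 : eulerSum q M e i = ∑ L ∈ Finset.range M, q ^ (i * L) * e L := rfl
  rw [← h4] at h
  linear_combination -h

theorem eulerSum_one_eq (hq : q ^ M = 0) {e : ℕ → A} (he0 : e 0 = 1)
    (he : ∀ n, e n = (1 - q ^ (n + 1)) * e (n + 1)) (n : ℕ) :
    eulerSum q M e 1 = e n * eulerSum q M e (n + 1) := by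
  induction n with
  | zero => simp [he0]
  | succ n ih =>
    rw [ih, eulerSum_succ hq he (Nat.le_add_left 1 n), he n]; ring

theorem eulerSum_eq_prod (hq : q ^ M = 0) {e : ℕ → A}
    (he : ∀ n, e n = (1 - q ^ (n + 1)) * e (n + 1)) (n : ℕ) :
    eulerSum q M e (n + 1) = (∏ b ∈ Finset.range n, (1 - q ^ (b + 1))) * eulerSum q M e 1 := by
  induction n with
  | zero => simp
  | succ n ih =>
    rw [eulerSum_succ hq he (Nat.le_add_left 1 n), ih, Finset.prod_range_succ]; ring

/-- The generating function `∑ L q ^ L / (q; q)_L` of the largest parts is the partition generating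
function times `∑ q ^ i / (1 - q ^ i)`; here `w i` stands for `1 / (1 - q ^ (i + 1))`. -/
theorem sum_natCast_mul_eq (hq : q ^ M = 0) {e : ℕ → A} (he0 : e 0 = 1)
    (he : ∀ n, e n = (1 - q ^ (n + 1)) * e (n + 1)) {w : ℕ → A}
    (hw : ∀ i, w i * (1 - q ^ (i + 1)) = 1) :
    ∑ L ∈ Finset.range M, (L : A) * q ^ L * e L =
      eulerSum q M e 1 * ∑ i ∈ Finset.range M, q ^ (i + 1) * w i := by
  -- `D i` is the value at `z = q ^ i` of `∑ L z ^ L / (q; q)_L`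
  let D : ℕ → A := fun i => ∑ L ∈ Finset.range M, (L : A) * q ^ (i * L) * e L
  have hD : ∀ i, 1 ≤ i → (1 - q ^ i) * D i = D (i + 1) + q ^ i * eulerSum q M e i := by
    intro i hi
    have h := sum_one_sub_pow_mul (M := M) he (fun L => (L : A) * q ^ (i * L))
      (by rw [pow_eq_zero_of_le (Nat.le_mul_of_pos_left M hi) hq, mul_zero])
    have h2 : ∑ L ∈ Finset.range M, q ^ L * ((L : A) * q ^ (i * L)) * e L = D (i + 1) :=
      Finset.sum_congr rfl fun L _ => by ring
    have h3 : ∑ L ∈ Finset.range M, ((L + 1 : ℕ) : A) * q ^ (i * (L + 1)) * e L =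
        q ^ i * (D i + eulerSum q M e i) := by
      simp only [D, eulerSum]
      rw [← Finset.sum_add_distrib, Finset.mul_sum]
      exact Finset.sum_congr rfl fun L _ => by push_cast; ring
    rw [h2, h3] at h
    have h4 : D i = ∑ L ∈ Finset.range M, (L : A) * q ^ (i * L) * e L := rfl
    rw [← h4] at h
    linear_combination h
  have key : ∀ n, D 1 = e n * D (n + 1) +
      eulerSum q M e 1 * ∑ i ∈ Finset.range n, q ^ (i + 1) * w i := by
    intro n
    induction n with
    | zero => simp [he0]
    | succ n ih =>
      rw [ih, Finset.sum_range_succ]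
      have h1 := hD (n + 1) (Nat.le_add_left 1 n)
      have h2 := eulerSum_one_eq hq he0 he n
      have h3 := he n
      have h4 := hw n
      linear_combination D (n + 1) * h3 + e (n + 1) * h1 - q ^ (n + 1) * w n * h2
        - q ^ (n + 1) * w n * eulerSum q M e (n + 1) * h3
        - q ^ (n + 1) * eulerSum q M e (n + 1) * e (n + 1) * h4
  have h0 : D (M + 1) = 0 := by
    refine Finset.sum_eq_zero fun L _ => ?_
    rcases Nat.eq_zero_or_pos L with rfl | hL
    · simp
    · rw [pow_eq_zero_of_le (by nlinarith) hq, mul_zero, zero_mul]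
  have h1 := key M
  rw [h0, mul_zero, zero_add] at h1
  rw [← h1]
  exact Finset.sum_congr rfl fun L _ => by rw [one_mul]

/-- The product `(q²; q²)_n`. -/
def evenPoch (q : A) (n : ℕ) : A :=
  ∏ b ∈ Finset.range n, (1 - (q ^ 2) ^ (b + 1))

theorem evenPoch_succ (n : ℕ) :
    evenPoch q (n + 1) = evenPoch q n * (1 - (q ^ 2) ^ (n + 1)) :=
  Finset.prod_range_succ _ _

/-- The generating function `∑ B_L / (q; q)_L` of the lengths of the runs of consecutive parts at
the top of a partition, as the partition generating function times `∑ q ^ (i + 1) (q²; q²)_i`. -/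
theorem sum_run_mul_eq (hq : q ^ M = 0) {e : ℕ → A}
    (he : ∀ n, e n = (1 - q ^ (n + 1)) * e (n + 1)) {B : ℕ → A} (hB0 : B 0 = 0)
    (hB : ∀ L, B (L + 1) = q ^ (L + 1) * (B L + 1)) :
    ∑ L ∈ Finset.range M, B L * e L = eulerSum q M e 1 *
      ∑ i ∈ Finset.range M, q ^ (i + 1) * evenPoch q i := by
  simp only [evenPoch]
  -- `R i` is the value at `z = q ^ i` of `∑ B_L z ^ L / (q; q)_L`
  let R : ℕ → A := fun i => ∑ L ∈ Finset.range M, B L * q ^ (i * L) * e L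
  have hBM : B M = 0 := by
    rcases M with _ | M
    · exact hB0
    · rw [hB, hq, zero_mul]
  have hR : ∀ i, R i = (1 + q ^ (i + 1)) * R (i + 1) + q ^ (i + 1) * eulerSum q M e (i + 1) := by
    intro i
    have h := sum_one_sub_pow_mul (M := M) he (fun L => B L * q ^ (i * L))
      (by rw [hBM, zero_mul])
    have h2 : ∑ L ∈ Finset.range M, q ^ L * (B L * q ^ (i * L)) * e L = R (i + 1) :=
      Finset.sum_congr rfl fun L _ => by ring
    have h3 : ∑ L ∈ Finset.range M, B (L + 1) * q ^ (i * (L + 1)) * e L =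
        q ^ (i + 1) * (R (i + 1) + eulerSum q M e (i + 1)) := by
      simp only [R, eulerSum]
      rw [← Finset.sum_add_distrib, Finset.mul_sum]
      exact Finset.sum_congr rfl fun L _ => by rw [hB]; ring
    rw [h2, h3] at h
    have h4 : R i = ∑ L ∈ Finset.range M, B L * q ^ (i * L) * e L := rfl
    rw [← h4] at h
    linear_combination h
  have key : ∀ n, R 0 = (∏ b ∈ Finset.range n, (1 + q ^ (b + 1))) * R n + eulerSum q M e 1 *
      ∑ i ∈ Finset.range n, q ^ (i + 1) * ∏ b ∈ Finset.range i, (1 - (q ^ 2) ^ (b + 1)) := by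
    intro n
    induction n with
    | zero => simp
    | succ n ih =>
      have h1 : ∏ b ∈ Finset.range n, (1 - (q ^ 2) ^ (b + 1)) =
          (∏ b ∈ Finset.range n, (1 + q ^ (b + 1))) *
            ∏ b ∈ Finset.range n, (1 - q ^ (b + 1)) := by
        rw [← Finset.prod_mul_distrib]
        exact Finset.prod_congr rfl fun b _ => by ring
      rw [ih, Finset.sum_range_succ, Finset.prod_range_succ, h1, hR n, eulerSum_eq_prod hq he n]
      ring
  have h0 : R M = 0 := by
    refine Finset.sum_eq_zero fun L _ => ?_
    rcases Nat.eq_zero_or_pos L with rfl | hL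
    · simp [hB0]
    · rw [pow_eq_zero_of_le (by nlinarith) hq, mul_zero, zero_mul]
  have h1 := key M
  rw [h0, mul_zero, zero_add] at h1
  rw [← h1]
  exact Finset.sum_congr rfl fun L _ => by rw [zero_mul, pow_zero, mul_one]

/-- A case of the Rogers–Fine identity:
`∑ q ^ (n + 1) (q²; q²)_n = ∑ (-1) ^ n q ^ ((n + 1) ^ 2) / (q; q²)_{n + 1}`; the denominator is
written as `(q; q)_{2 n + 1} / (q²; q²)_n`, with `f n` for `1 / (q; q)_n`. -/
theorem sum_evenPoch_eq (hq : q ^ M = 0) {f : ℕ → A} (hf0 : f 0 = 1)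
    (hf : ∀ n, f n = (1 - q ^ (n + 1)) * f (n + 1)) :
    ∑ n ∈ Finset.range M, q ^ (n + 1) * evenPoch q n =
      ∑ n ∈ Finset.range M, (-1) ^ n * q ^ ((n + 1) ^ 2) * (evenPoch q n * f (2 * n + 1)) := by
  -- `H i` is the value at `t = q ^ (2 i + 1)` of `∑ t ^ n (q²; q²)_n`
  let H : ℕ → A := fun i => ∑ n ∈ Finset.range M, q ^ ((2 * i + 1) * n) * evenPoch q n
  have hH : ∀ i, (1 - q ^ (2 * i + 1)) * H i = 1 - q ^ (2 * i + 3) * H (i + 1) := by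
    intro i
    have h1 : ∑ n ∈ Finset.range (M + 1), q ^ ((2 * i + 1) * n) * evenPoch q n = H i := by
      rw [Finset.sum_range_succ, pow_eq_zero_of_le (by nlinarith) hq, zero_mul, add_zero]
    have h2 : ∑ n ∈ Finset.range M, q ^ ((2 * i + 1) * (n + 1)) * evenPoch q (n + 1) =
        q ^ (2 * i + 1) * H i - q ^ (2 * i + 3) * H (i + 1) := by
      simp only [H, Finset.mul_sum]
      rw [← Finset.sum_sub_distrib]
      exact Finset.sum_congr rfl fun n _ => by rw [evenPoch_succ]; ring
    rw [Finset.sum_range_succ', h2] at h1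
    simp only [mul_zero, pow_zero, evenPoch, Finset.prod_range_zero, mul_one] at h1
    linear_combination -h1
  have hg : ∀ n, evenPoch q n * f (2 * n + 1) =
      (1 - q ^ (2 * n + 3)) * (evenPoch q (n + 1) * f (2 * (n + 1) + 1)) := by
    intro n
    rw [evenPoch_succ, hf (2 * n + 1), hf (2 * n + 1 + 1),
      show 2 * (n + 1) + 1 = 2 * n + 1 + 1 + 1 by ring]
    ring
  have key : ∀ m, q * H 0 =
      ∑ n ∈ Finset.range m, (-1) ^ n * q ^ ((n + 1) ^ 2) * (evenPoch q n * f (2 * n + 1)) +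
      (-1) ^ m * q ^ ((m + 1) ^ 2) * (evenPoch q m * f (2 * m + 1)) *
        ((1 - q ^ (2 * m + 1)) * H m) := by
    intro m
    induction m with
    | zero =>
      have h1 := hf 0
      simp only [hf0, zero_add, pow_one] at h1
      simp only [evenPoch, Finset.range_zero, Finset.sum_empty, Finset.prod_empty]
      simp only [mul_zero, zero_add, pow_one, one_pow, pow_zero, one_mul]
      linear_combination q * H 0 * h1
    | succ m ih =>
      rw [ih, hH m, Finset.sum_range_succ]
      have h1 := hg m
      have h2 : q ^ ((m + 1 + 1) ^ 2) = q ^ ((m + 1) ^ 2) * q ^ (2 * m + 3) := by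
        rw [← pow_add]; congr 1; ring
      have h3 : 2 * (m + 1) + 1 = 2 * m + 3 := by ring
      rw [h3] at h1 ⊢
      rw [h2]
      linear_combination (-1) ^ (m + 1) * q ^ ((m + 1) ^ 2) * q ^ (2 * m + 3) * H (m + 1) * h1
  have h1 := key M
  rw [pow_eq_zero_of_le (show M ≤ (M + 1) ^ 2 by nlinarith) hq] at h1
  simp only [mul_zero, zero_mul, add_zero] at h1
  rw [← h1, Finset.mul_sum]
  exact Finset.sum_congr rfl fun n _ => by ring

end QSeries

/-! ### A Bailey pair and the Hecke-type double sum -/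

section Bailey

variable {A : Type*} [CommRing A] {q : A} {M : ℕ}

open Finset.HasAntidiagonal in
/-- With `e n = 1 / (q²; q²)_n` and `f n = 1 / (q; q)_n`, the expansion
`1 / (q; q)_n = ∑ q ^ k / ((q²; q²)_k (q²; q²)_{n - k})`. -/
theorem inv_poch_eq_sum_antidiagonal {e f : ℕ → A} (he0 : e 0 = 1)
    (he : ∀ n, e n = (1 - (q ^ 2) ^ (n + 1)) * e (n + 1)) (hf0 : f 0 = 1)
    (hf : ∀ n, f n = (1 - q ^ (n + 1)) * f (n + 1)) (hu : ∀ n, IsUnit (1 - q ^ (n + 1))) (n : ℕ) :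
    f n = ∑ p ∈ antidiagonal n, q ^ p.1 * e p.1 * e p.2 := by
  induction n with
  | zero => simp [he0, hf0]
  | succ n ih =>
    have h1 : (1 - q ^ (n + 1)) * ∑ p ∈ antidiagonal (n + 1), q ^ p.1 * e p.1 * e p.2 =
        ∑ p ∈ antidiagonal n, q ^ p.1 * e p.1 * e p.2 := by
      have h2 : q ^ (n + 1) * ∑ p ∈ antidiagonal (n + 1), q ^ p.1 * e p.1 * e p.2 =
          ∑ p ∈ antidiagonal (n + 1), q ^ p.1 * (q ^ 2) ^ p.2 * e p.1 * e p.2 := by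
        rw [← Finset.Nat.sum_antidiagonal_swap, Finset.mul_sum]
        refine Finset.sum_congr rfl fun p hp => ?_
        rw [mem_antidiagonal] at hp
        rw [← hp]
        simp only [Prod.fst_swap, Prod.snd_swap]
        ring
      rw [sub_mul, one_mul, h2, ← Finset.sum_sub_distrib, Finset.Nat.sum_antidiagonal_succ']
      simp only [pow_zero, mul_one, sub_self, zero_add]
      refine Finset.sum_congr rfl fun p _ => ?_
      rw [he p.2]; ring
    refine (hu n).mul_left_cancel ?_
    rw [h1, ← hf n, ih]

/-- The odd case of the preceding expansion, with the terms `n - r` and `n + 1 + r` paired. -/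
theorem inv_poch_odd_eq_sum {e f : ℕ → A} (he0 : e 0 = 1)
    (he : ∀ n, e n = (1 - (q ^ 2) ^ (n + 1)) * e (n + 1)) (hf0 : f 0 = 1)
    (hf : ∀ n, f n = (1 - q ^ (n + 1)) * f (n + 1)) (hu : ∀ n, IsUnit (1 - q ^ (n + 1))) (n : ℕ) :
    f (2 * n + 1) = ∑ r ∈ Finset.range (n + 1),
      (q ^ (n - r) + q ^ (n + r + 1)) * (e (n - r) * e (n + r + 1)) := by
  rw [inv_poch_eq_sum_antidiagonal he0 he hf0 hf hu, Finset.Nat.sum_antidiagonal_eq_sum_range_succ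
    (fun k l => q ^ k * e k * e l), show (2 * n + 1).succ = (n + 1) + (n + 1) by omega,
    Finset.sum_range_add, ← Finset.sum_range_reflect, ← Finset.sum_add_distrib]
  refine Finset.sum_congr rfl fun r hr => ?_
  rw [Finset.mem_range] at hr
  rw [show n + 1 - 1 - r = n - r by omega, show 2 * n + 1 - (n - r) = n + r + 1 by omega,
    show 2 * n + 1 - (n + 1 + r) = n - r by omega, show n + 1 + r = n + r + 1 by omega]
  ring

/-- The Bailey pair: `q ^ (n + 1) / (q; q)_{2 n + 1}` as a combination of the numbers
`S (r + 1) - S r`, where `S` solves a recurrence of first order. The difference of the two sides,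
after `inv_poch_odd_eq_sum`, telescopes over `S r / ((q²; q²)_{n - r} (q²; q²)_{n + r})`. -/
theorem bailey_pair {e f S : ℕ → A} (he0 : e 0 = 1)
    (he : ∀ n, e n = (1 - (q ^ 2) ^ (n + 1)) * e (n + 1)) (hf0 : f 0 = 1)
    (hf : ∀ n, f n = (1 - q ^ (n + 1)) * f (n + 1)) (hu : ∀ n, IsUnit (1 - q ^ (n + 1)))
    (hS0 : S 0 = 0) (hS : ∀ r, S (r + 1) = q ^ (4 * r + 2) * S r + q ^ (3 * r + 2) + q ^ (r + 1))
    (n : ℕ) :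
    q ^ (n + 1) * f (2 * n + 1) =
      ∑ r ∈ Finset.range (n + 1), (S (r + 1) - S r) * (e (n - r) * e (n + r + 1)) := by
  let t : ℕ → A := fun r => if r ≤ n then S r * (e (n - r) * e (n + r)) else 0
  have hsum : ∑ r ∈ Finset.range (n + 1), (t (r + 1) - t r) = 0 := by
    rw [Finset.sum_range_sub]
    simp [t, hS0]
  rw [inv_poch_odd_eq_sum he0 he hf0 hf hu, Finset.mul_sum, ← add_zero (Finset.sum _ _), ← hsum,
    ← Finset.sum_add_distrib]
  refine Finset.sum_congr rfl fun r hr => ?_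
  obtain ⟨k, rfl⟩ := Nat.exists_eq_add_of_le (Nat.lt_succ_iff.mp (Finset.mem_range.mp hr))
  rw [hS]
  rcases k with _ | k
  · simp only [t, add_zero, tsub_self, pow_zero, he0, le_refl, if_true,
      show ¬ (r + 1 ≤ r) by omega, if_false]
    rw [he (r + r)]
    ring
  · simp only [t, show r + 1 ≤ r + (k + 1) by omega, show r ≤ r + (k + 1) by omega, if_true,
      show r + (k + 1) - r = k + 1 by omega, show r + (k + 1) - (r + 1) = k by omega]
    rw [hS, he k, show r + (k + 1) + (r + 1) = r + (k + 1) + r + 1 by ring,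
      he (r + (k + 1) + r)]
    ring

/-- `1 / (q²; q²)_{n - r}`, read as `0` for `n < r`; here `e n` stands for `1 / (q²; q²)_n`. -/
def shiftInv (e : ℕ → A) (n r : ℕ) : A :=
  if r ≤ n then e (n - r) else 0

theorem shiftInv_add (e : ℕ → A) (r k : ℕ) : shiftInv e (r + k) r = e k := by
  simp [shiftInv]

theorem shiftInv_of_lt (e : ℕ → A) {n r : ℕ} (h : n < r) : shiftInv e n r = 0 := by
  simp [shiftInv, h]

theorem evenPoch_mul_inv {e : ℕ → A} (he0 : e 0 = 1)
    (he : ∀ n, e n = (1 - (q ^ 2) ^ (n + 1)) * e (n + 1)) (n : ℕ) : evenPoch q n * e n = 1 := by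
  induction n with
  | zero => simp [evenPoch, he0]
  | succ n ih =>
    rw [evenPoch_succ, mul_assoc, ← he, ih]

/-- The conjugate Bailey pair used below. Both steps of the induction on `r` telescope. -/
theorem conjugate_bailey_pair (hq : q ^ M = 0) {e : ℕ → A} (he0 : e 0 = 1)
    (he : ∀ n, e n = (1 - (q ^ 2) ^ (n + 1)) * e (n + 1)) (r : ℕ) :
    ∑ n ∈ Finset.range M, (-1) ^ n * q ^ (n * (n + 1)) * evenPoch q n *
      (shiftInv e n r * e (n + r + 1)) = (-1) ^ r * q ^ (r * (r + 1)) := by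
  have hM : q ^ (M * (M + 1)) = 0 := pow_eq_zero_of_le (by nlinarith) hq
  induction r with
  | zero =>
    have h1 : ∀ n, (-1) ^ n * q ^ (n * (n + 1)) * evenPoch q n *
        (shiftInv e n 0 * e (n + 0 + 1)) =
        (-1) ^ n * q ^ (n * (n + 1)) * e n -
          (-1) ^ (n + 1) * q ^ ((n + 1) * (n + 1 + 1)) * e (n + 1) := by
      intro n
      have h2 := evenPoch_mul_inv he0 he n
      have h3 := shiftInv_add e 0 n
      rw [zero_add] at h3
      rw [h3, add_zero]
      linear_combination (-1) ^ n * q ^ (n * (n + 1)) * e (n + 1) * h2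
        - (-1) ^ n * q ^ (n * (n + 1)) * he n
    rw [Finset.sum_congr rfl fun n _ => h1 n, Finset.sum_range_sub', hM]
    simp [he0]
  | succ r ih =>
    -- a certificate for the recurrence `G (r + 1) = -(q²) ^ (r + 1) G r` of the left-hand sides
    let g : ℕ → A := fun n => (1 + (q ^ 2) ^ (r + 1)) * ((-1) ^ n * q ^ (n * (n + 1)) *
      evenPoch q n * (shiftInv e n (r + 1) * e (n + r + 1)))
    have h1 : ∀ n, (-1) ^ n * q ^ (n * (n + 1)) * evenPoch q n *
        (shiftInv e n (r + 1) * e (n + (r + 1) + 1)) + (q ^ 2) ^ (r + 1) *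
        ((-1) ^ n * q ^ (n * (n + 1)) * evenPoch q n * (shiftInv e n r * e (n + r + 1))) =
        g n - g (n + 1) := by
      intro n
      simp only [g]
      rcases lt_or_ge n r with hn | hn
      · rw [shiftInv_of_lt e hn, shiftInv_of_lt e (show n < r + 1 by omega),
          shiftInv_of_lt e (show n + 1 < r + 1 by omega)]
        ring
      · obtain ⟨k, rfl⟩ := Nat.exists_eq_add_of_le hn
        have h2 : shiftInv e (r + k) (r + 1) = (1 - (q ^ 2) ^ k) * e k := by
          rcases k with _ | k
          · rw [shiftInv_of_lt e (by omega)]; ring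
          · rw [show r + (k + 1) = r + 1 + k by ring, shiftInv_add, he k]
        have h3 : shiftInv e (r + k + 1) (r + 1) = e k := by
          rw [show r + k + 1 = r + 1 + k by ring, shiftInv_add]
        rw [h2, h3, shiftInv_add, evenPoch_succ,
          show r + k + (r + 1) + 1 = r + k + r + 1 + 1 by ring,
          show r + k + 1 + r + 1 = r + k + r + 1 + 1 by ring, he (r + k + r + 1)]
        ring
    have h2 := Finset.sum_congr (rfl : Finset.range M = _) fun n _ => h1 n
    rw [Finset.sum_range_sub', Finset.sum_add_distrib, ← Finset.mul_sum, ih] at h2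
    simp only [g, hM, shiftInv_of_lt e (Nat.succ_pos r)] at h2
    linear_combination h2

/-- The Hecke-type double sum for `∑ q ^ (n + 1) (q²; q²)_n`, in terms of the sequence `S` of
`bailey_pair`. -/
theorem sum_evenPoch_eq_hecke (hq : q ^ M = 0) {e f S : ℕ → A} (he0 : e 0 = 1)
    (he : ∀ n, e n = (1 - (q ^ 2) ^ (n + 1)) * e (n + 1)) (hf0 : f 0 = 1)
    (hf : ∀ n, f n = (1 - q ^ (n + 1)) * f (n + 1)) (hu : ∀ n, IsUnit (1 - q ^ (n + 1)))
    (hS0 : S 0 = 0) (hS : ∀ r, S (r + 1) = q ^ (4 * r + 2) * S r + q ^ (3 * r + 2) + q ^ (r + 1)) :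
    ∑ n ∈ Finset.range M, q ^ (n + 1) * evenPoch q n =
      ∑ r ∈ Finset.range M, (-1) ^ r * (q ^ (r * (r + 1)) + q ^ ((r + 1) * (r + 2))) *
        S (r + 1) := by
  have h1 : ∀ n ∈ Finset.range M,
      (-1) ^ n * q ^ ((n + 1) ^ 2) * (evenPoch q n * f (2 * n + 1)) =
      ∑ r ∈ Finset.range M, (S (r + 1) - S r) * ((-1) ^ n * q ^ (n * (n + 1)) * evenPoch q n *
        (shiftInv e n r * e (n + r + 1))) := by
    intro n hn
    have h2 := bailey_pair he0 he hf0 hf hu hS0 hS n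
    have h3 : ∑ r ∈ Finset.range (n + 1), (S (r + 1) - S r) * (e (n - r) * e (n + r + 1)) =
        ∑ r ∈ Finset.range M, (S (r + 1) - S r) * (shiftInv e n r * e (n + r + 1)) := by
      have h4 : Finset.range (n + 1) ⊆ Finset.range M :=
        Finset.range_subset_range.mpr (Finset.mem_range.mp hn)
      rw [← Finset.sum_subset h4]
      · refine Finset.sum_congr rfl fun r hr => ?_
        rw [shiftInv, if_pos (Nat.lt_succ_iff.mp (Finset.mem_range.mp hr))]
      · intro r _ hr
        rw [shiftInv_of_lt e (by simpa using hr)]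
        ring
    rw [h3] at h2
    rw [show (n + 1) ^ 2 = n * (n + 1) + (n + 1) by ring, pow_add]
    calc _ = (-1) ^ n * q ^ (n * (n + 1)) * evenPoch q n * (q ^ (n + 1) * f (2 * n + 1)) := by ring
      _ = _ := by
        rw [h2, Finset.mul_sum]
        exact Finset.sum_congr rfl fun r _ => by ring
  rw [sum_evenPoch_eq hq hf0 hf, Finset.sum_congr rfl h1, Finset.sum_comm]
  simp only [← Finset.mul_sum, conjugate_bailey_pair hq he0 he]
  have h2 : ∀ r, (S (r + 1) - S r) * ((-1) ^ r * q ^ (r * (r + 1))) =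
      (-1) ^ r * (q ^ (r * (r + 1)) + q ^ ((r + 1) * (r + 2))) * S (r + 1) +
      ((-1) ^ (r + 1) * q ^ ((r + 1) * (r + 1 + 1)) * S (r + 1) -
        (-1) ^ r * q ^ (r * (r + 1)) * S r) := fun r => by ring
  rw [Finset.sum_congr rfl fun r _ => h2 r, Finset.sum_add_distrib,
    Finset.sum_range_sub fun r => (-1) ^ r * q ^ (r * (r + 1)) * S r, hS0,
    pow_eq_zero_of_le (show M ≤ M * (M + 1) by nlinarith) hq]
  ring

/-- The solution `S r = ∑_{j < 2 r} q ^ (2 r ^ 2 - j (j + 1) / 2)` of the recurrence in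
`bailey_pair`. -/
def heckeInner (q : A) (r : ℕ) : A :=
  ∑ j ∈ Finset.range (2 * r), q ^ (2 * r ^ 2 - j * (j + 1) / 2)

theorem triangle_lt {r j : ℕ} (h : j < 2 * r) : j * (j + 1) / 2 < 2 * r ^ 2 := by
  refine Nat.div_lt_of_lt_mul ?_
  nlinarith

theorem heckeInner_succ (r : ℕ) :
    heckeInner q (r + 1) = q ^ (4 * r + 2) * heckeInner q r + q ^ (3 * r + 2) + q ^ (r + 1) := by
  have h0 : ∀ j ∈ Finset.range (2 * r), q ^ (2 * (r + 1) ^ 2 - j * (j + 1) / 2) =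
      q ^ (4 * r + 2) * q ^ (2 * r ^ 2 - j * (j + 1) / 2) := by
    intro j hj
    have h1 := triangle_lt (Finset.mem_range.mp hj)
    rw [← pow_add]
    congr 1
    have h2 : 2 * (r + 1) ^ 2 = 2 * r ^ 2 + (4 * r + 2) := by ring
    omega
  have h1 : 2 * (r + 1) ^ 2 - 2 * r * (2 * r + 1) / 2 = 3 * r + 2 := by
    rw [show 2 * r * (2 * r + 1) = 2 * (2 * r ^ 2 + r) by ring, Nat.mul_div_cancel_left _ two_pos,
      show 2 * (r + 1) ^ 2 = 2 * r ^ 2 + r + (3 * r + 2) by ring, Nat.add_sub_cancel_left]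
  have h2 : 2 * (r + 1) ^ 2 - (2 * r + 1) * (2 * r + 1 + 1) / 2 = r + 1 := by
    rw [show (2 * r + 1) * (2 * r + 1 + 1) = 2 * (2 * r ^ 2 + 3 * r + 1) by ring,
      Nat.mul_div_cancel_left _ two_pos,
      show 2 * (r + 1) ^ 2 = 2 * r ^ 2 + 3 * r + 1 + (r + 1) by ring, Nat.add_sub_cancel_left]
  rw [heckeInner, show 2 * (r + 1) = 2 * r + 1 + 1 by ring, Finset.sum_range_succ,
    Finset.sum_range_succ, h1, h2, Finset.sum_congr rfl h0, ← Finset.mul_sum, heckeInner]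

end Bailey

/-! ### Reduced solutions of the Pell equation -/

section Pell

/-- A solution in the fundamental domain `0 < u`, `5 u < 12 v`: the point itself has a positive
first coordinate, and its image under `5 - 2√6` has a negative one. -/
def IsPellReduced {m : ℤ} (x : PellSol m) : Prop :=
  0 < x.1.re ∧ 5 * x.1.re < 12 * x.1.im

theorem pellUnit_mul_re (x : ℤ√6) : ((pellUnit : ℤ√6) * x).re = 5 * x.re + 12 * x.im := by
  simp only [pellUnit, Zsqrtd.re_mul]; ring

theorem pellUnit_mul_im (x : ℤ√6) : ((pellUnit : ℤ√6) * x).im = 5 * x.im + 2 * x.re := by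
  simp only [pellUnit, Zsqrtd.im_mul]

theorem pellUnit_inv_mul_re (x : ℤ√6) :
    (((pellUnit⁻¹ : (ℤ√6)ˣ) : ℤ√6) * x).re = 5 * x.re - 12 * x.im := by
  simp only [pellUnit, Units.inv_mk, Zsqrtd.re_mul]; ring

theorem pellUnit_inv_mul_im (x : ℤ√6) :
    (((pellUnit⁻¹ : (ℤ√6)ˣ) : ℤ√6) * x).im = 5 * x.im - 2 * x.re := by
  simp only [pellUnit, Units.inv_mk, Zsqrtd.im_mul]; ring

variable {m : ℤ}

/-- Multiplication of a solution by `5 + 2√6`. -/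
def pellNext (x : PellSol m) : PellSol m :=
  ⟨(pellUnit : ℤ√6) * x.1, by
    have h := x.2
    rw [pellUnit_mul_re, pellUnit_mul_im]
    linear_combination h⟩

/-- Multiplication of a solution by `5 - 2√6`. -/
def pellPrev (x : PellSol m) : PellSol m :=
  ⟨((pellUnit⁻¹ : (ℤ√6)ˣ) : ℤ√6) * x.1, by
    have h := x.2
    rw [pellUnit_inv_mul_re, pellUnit_inv_mul_im]
    linear_combination h⟩

theorem pellEquiv_next (x : PellSol m) : PellEquiv x (pellNext x) :=
  ⟨1, Or.inl (by simp [pellNext])⟩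

theorem pellEquiv_prev (x : PellSol m) : PellEquiv x (pellPrev x) :=
  ⟨-1, Or.inl (by simp [pellPrev])⟩

theorem next_re (x : PellSol m) : (pellNext x).1.re = 5 * x.1.re + 12 * x.1.im :=
  pellUnit_mul_re x.1

theorem next_im (x : PellSol m) : (pellNext x).1.im = 5 * x.1.im + 2 * x.1.re :=
  pellUnit_mul_im x.1

theorem prev_re (x : PellSol m) : (pellPrev x).1.re = 5 * x.1.re - 12 * x.1.im :=
  pellUnit_inv_mul_re x.1

theorem prev_im (x : PellSol m) : (pellPrev x).1.im = 5 * x.1.im - 2 * x.1.re :=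
  pellUnit_inv_mul_im x.1

theorem abs_re_lt (hm : m < 0) (x : PellSol m) (hv : 0 < x.1.im) :
    -(5 * x.1.im) < 2 * x.1.re ∧ 2 * x.1.re < 5 * x.1.im := by
  have h := x.2
  constructor <;> nlinarith

theorem re_lt (hm : m < 0) (x : PellSol m) (hv : 0 < x.1.im) : x.1.re < 3 * x.1.im := by
  have h := x.2
  nlinarith

theorem re_ne_zero (hm : Odd m) (x : PellSol m) : x.1.re ≠ 0 := by
  intro h0
  have h := x.2
  rw [h0] at h
  obtain ⟨l, hl⟩ := hm
  have : 2 * (-3 * x.1.im ^ 2 - l) = 1 := by linarith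
  omega

/-- Multiplying by powers of `5 + 2√6` makes the first coordinate positive. -/
theorem exists_equiv_re_pos (hm : m < 0) (hodd : Odd m) (N : ℕ) :
    ∀ x : PellSol m, 0 < x.1.im → -x.1.re ≤ N → ∃ y, PellEquiv x y ∧ 0 < y.1.im ∧ 0 < y.1.re := by
  induction N with
  | zero =>
    intro x hv hx
    have := re_ne_zero hodd x
    exact ⟨x, (pellEquiv_equivalence m).refl x, hv, by push_cast at hx; omega⟩
  | succ N ih =>
    intro x hv hx
    obtain ⟨h1, h2⟩ := abs_re_lt hm x hv
    obtain ⟨y, hy, h⟩ := ih (pellNext x) (by rw [next_im]; omega)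
      (by rw [next_re]; push_cast at hx; omega)
    exact ⟨y, (pellEquiv_equivalence m).trans (pellEquiv_next x) hy, h⟩

/-- Multiplying by powers of `5 - 2√6` as long as the first coordinate remains positive. -/
theorem exists_equiv_reduced_of_pos (hm : m < 0) (hodd : Odd m) (N : ℕ) :
    ∀ x : PellSol m, 0 < x.1.im → 0 < x.1.re → x.1.re ≤ N →
      ∃ y, PellEquiv x y ∧ IsPellReduced y := by
  induction N with
  | zero => intro x _ h1 h2; push_cast at h2; omega
  | succ N ih =>
    intro x hv hu hx
    obtain ⟨h1, h2⟩ := abs_re_lt hm x hv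
    have h3 := re_lt hm x hv
    have h4 := re_ne_zero hodd (pellPrev x)
    rw [prev_re] at h4
    by_cases h5 : 5 * x.1.re < 12 * x.1.im
    · exact ⟨x, (pellEquiv_equivalence m).refl x, hu, h5⟩
    · obtain ⟨y, hy, h⟩ := ih (pellPrev x) (by rw [prev_im]; omega) (by rw [prev_re]; omega)
        (by rw [prev_re]; push_cast at hx; omega)
      exact ⟨y, (pellEquiv_equivalence m).trans (pellEquiv_prev x) hy, h⟩

theorem exists_equiv_reduced (hm : m < 0) (hodd : Odd m) (x : PellSol m) :
    ∃ y, PellEquiv x y ∧ IsPellReduced y := by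
  have hpos : ∃ y : PellSol m, PellEquiv x y ∧ 0 < y.1.im := by
    rcases lt_trichotomy x.1.im 0 with h | h | h
    · exact ⟨⟨-x.1, by simpa using x.2⟩, ⟨0, Or.inr (by simp)⟩, by simpa using h⟩
    · have h2 := x.2
      rw [h] at h2
      nlinarith [sq_nonneg x.1.re]
    · exact ⟨x, (pellEquiv_equivalence m).refl x, h⟩
  obtain ⟨y, hy, hv⟩ := hpos
  obtain ⟨z, hz, hv, hu⟩ := exists_equiv_re_pos hm hodd (-y.1.re).toNat y hv (Int.self_le_toNat _)
  obtain ⟨w, hw, hr⟩ := exists_equiv_reduced_of_pos hm hodd z.1.re.toNat z hv hu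
    (Int.self_le_toNat _)
  exact ⟨w, (pellEquiv_equivalence m).trans hy ((pellEquiv_equivalence m).trans hz hw), hr⟩

theorem pellUnit_pow_mul_pos (x : ℤ√6) (hu : 0 < x.re) (hv : 0 < x.im) (n : ℕ) :
    0 < (((pellUnit ^ n : (ℤ√6)ˣ) : ℤ√6) * x).re ∧
      0 < (((pellUnit ^ n : (ℤ√6)ˣ) : ℤ√6) * x).im := by
  induction n with
  | zero => simpa using ⟨hu, hv⟩
  | succ n ih =>
    rw [pow_succ', Units.val_mul, mul_assoc, pellUnit_mul_re, pellUnit_mul_im]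
    omega

/-- A reduced solution is not a positive power of `5 + 2√6` times a reduced solution, up to sign:
before the last multiplication by `5 + 2√6` both coordinates would have to be positive. -/
theorem not_reduced_of_pow_succ {x y : PellSol m} (hx : IsPellReduced x)
    (hy : IsPellReduced y) (n : ℕ) :
    ¬ (y.1 = ((pellUnit ^ (n + 1) : (ℤ√6)ˣ) : ℤ√6) * x.1 ∨
      y.1 = -(((pellUnit ^ (n + 1) : (ℤ√6)ˣ) : ℤ√6) * x.1)) := by
  obtain ⟨hx1, hx2⟩ := hx
  obtain ⟨hy1, hy2⟩ := hy
  obtain ⟨h1, h2⟩ := pellUnit_pow_mul_pos x.1 hx1 (by omega) n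
  rw [pow_succ', Units.val_mul, mul_assoc]
  rintro (h | h)
  · rw [h, pellUnit_mul_re, pellUnit_mul_im] at hy2
    omega
  · rw [h, Zsqrtd.re_neg, pellUnit_mul_re] at hy1
    omega

theorem eq_of_equiv_of_reduced {x y : PellSol m} (hx : IsPellReduced x) (hy : IsPellReduced y)
    (h : PellEquiv x y) : x = y := by
  have key : ∀ {x y : PellSol m}, IsPellReduced x → IsPellReduced y → ∀ n : ℕ,
      (y.1 = ((pellUnit ^ (n : ℤ) : (ℤ√6)ˣ) : ℤ√6) * x.1 ∨
      y.1 = -(((pellUnit ^ (n : ℤ) : (ℤ√6)ˣ) : ℤ√6) * x.1)) → x = y := by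
    intro x y hx hy n h
    rcases n with _ | n
    · rcases h with h | h
      · exact Subtype.ext (by simpa using h.symm)
      · have h1 := hx.1
        have h2 := hy.1
        rw [h] at h2
        simp at h2
        omega
    · rw [zpow_natCast] at h
      exact absurd h (not_reduced_of_pow_succ hx hy n)
  obtain ⟨r, h⟩ := h
  obtain ⟨n, rfl | rfl⟩ := Int.eq_nat_or_neg r
  · exact key hx hy n h
  · refine (key hy hx n ?_).symm
    rcases h with h | h
    · exact Or.inl (by rw [h, ← mul_assoc, ← Units.val_mul, ← zpow_add]; simp)
    · exact Or.inr (by rw [h, mul_neg, ← mul_assoc, ← Units.val_mul, ← zpow_add]; simp)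

/-- Each class contains exactly one reduced solution, so that `pellCount` counts the reduced
solutions with the given residue. -/
theorem pellCount_eq_ncard_reduced (hm : m < 0) (hodd : Odd m) {a : ℤ} (ha : a = 1 ∨ a = 5) :
    pellCount m a = Set.ncard {x : PellSol m | IsPellReduced x ∧
      (x.1.re + 3 * x.1.im ≡ a [ZMOD 12] ∨ x.1.re + 3 * x.1.im ≡ -a [ZMOD 12])} := by
  symm
  refine Set.ncard_congr (fun x _ => Quotient.mk (pellSetoid m) x) ?_ ?_ ?_
  · rintro x ⟨_, hx⟩
    exact ⟨x, rfl, hx⟩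
  · rintro x y ⟨hx, _⟩ ⟨hy, _⟩ h
    exact eq_of_equiv_of_reduced hx hy (Quotient.exact h)
  · rintro _ ⟨x, rfl, hx⟩
    obtain ⟨y, hy, hr⟩ := exists_equiv_reduced hm hodd x
    exact ⟨y, ⟨hr, pellEquiv_residue hodd ha hy hx⟩,
      Quotient.sound ((pellEquiv_equivalence m).symm hy)⟩

end Pell

/-! ### Reduced solutions and the terms of the double sum -/

section Count

/-- The triples `(r, j, b)` that index the terms of the Hecke-type double sum with exponent `k`. -/
def heckeIndex (M k : ℕ) : Finset (ℕ × ℕ × Bool) :=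
  (Finset.range M ×ˢ Finset.range (2 * M) ×ˢ Finset.univ).filter fun z =>
    z.2.1 < 2 * (z.1 + 1) ∧
      (bif z.2.2 then (z.1 + 1) * (z.1 + 2) else z.1 * (z.1 + 1)) + 2 * (z.1 + 1) ^ 2 =
        k + z.2.1 * (z.2.1 + 1) / 2

/-- The number `x = 6 (r + 1) ± 1` attached to `(r, b)`. -/
def heckeX (r : ℕ) (b : Bool) : ℤ :=
  6 * ((r : ℤ) + 1) + bif b then 1 else -1

/-- In terms of `x = 6 (r + 1) ± 1` and `y = 2 j + 1` the exponent `k` satisfies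
`2 x ^ 2 - 3 y ^ 2 = 24 k - 1`. -/
theorem hecke_exponent_iff (r j k : ℕ) (b : Bool) :
    (bif b then (r + 1) * (r + 2) else r * (r + 1)) + 2 * (r + 1) ^ 2 = k + j * (j + 1) / 2 ↔
      2 * heckeX r b ^ 2 - 3 * (2 * (j : ℤ) + 1) ^ 2 = 24 * k - 1 := by
  obtain ⟨t, ht⟩ := (Nat.even_mul_succ_self j).two_dvd
  have h1 : j * (j + 1) / 2 = t := by omega
  have h2 : (j : ℤ) * (j + 1) = 2 * t := by exact_mod_cast ht
  rw [h1]
  zify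
  cases b
  · simp only [heckeX, cond_false]
    push_cast
    constructor <;> intro h <;> linarith
  · simp only [heckeX, cond_true]
    push_cast
    constructor <;> intro h <;> linarith

variable {k : ℕ}

theorem pell_parity (x : PellSol (1 - 24 * (k : ℤ))) :
    x.1.re % 2 = 1 ∧ x.1.im % 2 = 0 ∧ x.1.re % 3 ≠ 0 := by
  have h := x.2
  generalize x.1.re = u at *
  generalize x.1.im = v at *
  have h1 : u % 2 = 1 := by
    by_contra h2
    obtain ⟨t, rfl⟩ : ∃ t, u = 2 * t := ⟨u / 2, by omega⟩
    have : 2 * (2 * t ^ 2 - 3 * v ^ 2 + 12 * k) = 1 := by linarith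
    omega
  refine ⟨h1, ?_, ?_⟩
  · by_contra h2
    obtain ⟨t, rfl⟩ : ∃ t, u = 2 * t + 1 := ⟨u / 2, by omega⟩
    obtain ⟨l, rfl⟩ : ∃ l, v = 2 * l + 1 := ⟨v / 2, by omega⟩
    have : 2 * (2 * (t ^ 2 + t) - 12 * (l ^ 2 + l) + 12 * k) = 6 := by linarith
    have : 2 * (t ^ 2 + t - 6 * (l ^ 2 + l) + 6 * k) = 3 := by linarith
    omega
  · intro h2
    obtain ⟨t, rfl⟩ : ∃ t, u = 3 * t := ⟨u / 3, by omega⟩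
    have : 3 * (3 * t ^ 2 - 2 * v ^ 2 + 8 * k) = 1 := by linarith
    omega

/-- The reduced solutions with `σ (u - 2 v) > 0`, for a sign `σ`, correspond to the indices
`(r, j, b)` by `u = 2 x + 3 σ y`, `v = x + σ y`, where `x = 6 (r + 1) ± 1` and `y = 2 j + 1`. The
parity of `r + 1` decides whether `u + 3 v` is `±1` or `±5` modulo `12`. -/
theorem ncard_reduced_sign {M : ℕ} (hM : k < M) {σ : ℤ} (hσ : σ = 1 ∨ σ = -1) {t : ℕ}
    (ht : t = 0 ∨ t = 1) :
    Set.ncard {x : PellSol (1 - 24 * (k : ℤ)) | IsPellReduced x ∧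
      (x.1.re + 3 * x.1.im ≡ 1 + 4 * t [ZMOD 12] ∨ x.1.re + 3 * x.1.im ≡ -(1 + 4 * t) [ZMOD 12]) ∧
      0 < σ * (x.1.re - 2 * x.1.im)} =
      ((heckeIndex M k).filter fun z => (z.1 + 1) % 2 = t).card := by
  rw [← Set.ncard_coe_finset]
  symm
  have hσ2 : σ ^ 2 = 1 := by rcases hσ with rfl | rfl <;> norm_num
  refine Set.ncard_congr (fun z hz =>
    ⟨⟨2 * heckeX z.1 z.2.2 + 3 * σ * (2 * (z.2.1 : ℤ) + 1),
      heckeX z.1 z.2.2 + σ * (2 * (z.2.1 : ℤ) + 1)⟩, ?_⟩) ?_ ?_ ?_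
  · have h1 := (Finset.mem_filter.mp (Finset.mem_filter.mp (Finset.mem_coe.mp hz)).1).2.2
    rw [hecke_exponent_iff] at h1
    linear_combination -h1 + 3 * (2 * (z.2.1 : ℤ) + 1) ^ 2 * hσ2
  · rintro ⟨r, j, b⟩ hz
    simp only [heckeIndex, Finset.coe_filter, Finset.mem_filter, Set.mem_ofPred_eq] at hz
    obtain ⟨⟨-, hj, -⟩, hp⟩ := hz
    simp only [Set.mem_ofPred_eq, IsPellReduced, Int.ModEq]
    have hx : heckeX r b = 6 * ((r : ℤ) + 1) + 1 ∨ heckeX r b = 6 * ((r : ℤ) + 1) - 1 := by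
      cases b
      · exact Or.inr rfl
      · exact Or.inl rfl
    generalize heckeX r b = x at *
    rcases hσ with rfl | rfl <;> rcases ht with rfl | rfl <;> rcases hx with rfl | rfl <;>
      push_cast <;> refine ⟨⟨by omega, by omega⟩, ?_, by omega⟩ <;> omega
  · rintro ⟨r, j, b⟩ ⟨r', j', b'⟩ _ _ h
    have h1 := congrArg (fun w => w.1.re) h
    have h2 := congrArg (fun w => w.1.im) h
    simp only at h1 h2
    have h3 : heckeX r b = heckeX r' b' := by linarith
    have h4 : j = j' := by rcases hσ with rfl | rfl <;> omega
    simp only [heckeX] at h3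
    cases b <;> cases b' <;> simp only [cond_true, cond_false] at h3
    · exact Prod.ext (by simp only; omega) (Prod.ext h4 rfl)
    · omega
    · omega
    · exact Prod.ext (by simp only; omega) (Prod.ext h4 rfl)
  -- the inverse is `x = 3 v - u`, `σ y = u - 2 v`
  · rintro x ⟨⟨hr1, hr2⟩, hres, hs⟩
    obtain ⟨hp1, hp2, hp3⟩ := pell_parity x
    have hx := x.2
    simp only [Int.ModEq] at hres
    obtain ⟨j, hj⟩ : ∃ j : ℕ, x.1.re - 2 * x.1.im = σ * (2 * (j : ℤ) + 1) := by
      refine ⟨((σ * (x.1.re - 2 * x.1.im) - 1) / 2).toNat, ?_⟩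
      rcases hσ with rfl | rfl <;> omega
    have hX : ∃ (r : ℕ) (b : Bool), 3 * x.1.im - x.1.re = heckeX r b := by
      have h1 : (3 * x.1.im - x.1.re) % 6 = 1 ∨ (3 * x.1.im - x.1.re) % 6 = 5 := by omega
      rcases h1 with h1 | h1
      · refine ⟨((3 * x.1.im - x.1.re) / 6 - 1).toNat, true, ?_⟩
        simp only [heckeX, cond_true]
        rcases hσ with rfl | rfl <;> omega
      · refine ⟨((3 * x.1.im - x.1.re) / 6).toNat, false, ?_⟩
        simp only [heckeX, cond_false]
        rcases hσ with rfl | rfl <;> omega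
    obtain ⟨r, b, hX⟩ := hX
    have hu : x.1.re = 2 * heckeX r b + 3 * σ * (2 * (j : ℤ) + 1) := by linarith
    have hv : x.1.im = heckeX r b + σ * (2 * (j : ℤ) + 1) := by linarith
    have hexp : 2 * heckeX r b ^ 2 - 3 * (2 * (j : ℤ) + 1) ^ 2 = 24 * k - 1 := by
      rw [← hX]
      linear_combination -hx + 3 * (x.1.re - 2 * x.1.im + σ * (2 * (j : ℤ) + 1)) * hj +
        3 * (2 * (j : ℤ) + 1) ^ 2 * hσ2
    have hb : heckeX r b = 6 * ((r : ℤ) + 1) + 1 ∨ heckeX r b = 6 * ((r : ℤ) + 1) - 1 := by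
      cases b
      · exact Or.inr rfl
      · exact Or.inl rfl
    have hlt : 3 * (2 * (j : ℤ) + 1) < 2 * heckeX r b := by
      rcases hσ with rfl | rfl <;> linarith
    have hjr : j < 2 * (r + 1) := by rcases hb with hb | hb <;> rw [hb] at hlt <;> omega
    have hrk : r + 1 ≤ k := by
      have h1 : 6 * ((r : ℤ) + 1) - 1 ≤ heckeX r b := by rcases hb with hb | hb <;> omega
      have h2 : 9 * (2 * (j : ℤ) + 1) ^ 2 < 4 * heckeX r b ^ 2 := by nlinarith
      have h3 : (6 * ((r : ℤ) + 1) - 1) ^ 2 ≤ heckeX r b ^ 2 :=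
        pow_le_pow_left₀ (by omega) h1 2
      zify
      by_contra h4
      nlinarith [sq_nonneg (r : ℤ)]
    refine ⟨(r, j, b), ?_, Subtype.ext (Zsqrtd.ext hu.symm hv.symm)⟩
    simp only [heckeIndex, Finset.coe_filter, Finset.mem_filter, Set.mem_ofPred_eq,
      Finset.mem_product, Finset.mem_range, Finset.mem_univ, and_true]
    refine ⟨⟨⟨by omega, by omega⟩, hjr, (hecke_exponent_iff r j k b).mpr hexp⟩, ?_⟩
    rw [hu, hv] at hres
    rcases hσ with rfl | rfl <;> rcases ht with rfl | rfl <;> rcases hb with hb | hb <;>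
      rw [hb] at hres <;> omega

theorem pellCount_eq_card {M : ℕ} (hk : 1 ≤ k) (hM : k < M) {t : ℕ} (ht : t = 0 ∨ t = 1) :
    pellCount (1 - 24 * (k : ℤ)) (1 + 4 * t) =
      2 * ((heckeIndex M k).filter fun z => (z.1 + 1) % 2 = t).card := by
  have hm : 1 - 24 * (k : ℤ) < 0 := by omega
  have hodd : Odd (1 - 24 * (k : ℤ)) := ⟨-12 * k, by ring⟩
  have hfin : ∀ s : Set (PellSol (1 - 24 * (k : ℤ))), (∀ x ∈ s, IsPellReduced x) → s.Finite := by
    intro s hs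
    have := finite_pell_classes hm.ne
    refine Set.Finite.of_injOn (f := Quotient.mk (pellSetoid (1 - 24 * (k : ℤ))))
      (t := Set.univ) (fun _ _ => Set.mem_univ _) ?_ Set.finite_univ
    exact fun x hx y hy h => eq_of_equiv_of_reduced (hs x hx) (hs y hy) (Quotient.exact h)
  rw [pellCount_eq_ncard_reduced hm hodd (by rcases ht with rfl | rfl <;> norm_num), two_mul]
  nth_rewrite 1 [← ncard_reduced_sign hM (Or.inl rfl) ht]
  rw [← ncard_reduced_sign hM (Or.inr rfl) ht, ← Set.ncard_union_eq ?_
    (hfin _ fun x hx => hx.1) (hfin _ fun x hx => hx.1)]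
  · congr 1
    ext x
    simp only [Set.mem_union, Set.mem_ofPred_eq]
    constructor
    · rintro ⟨h1, h2⟩
      have h3 := (pell_parity x).1
      rcases lt_or_ge 0 (x.1.re - 2 * x.1.im) with h4 | h4
      · exact Or.inl ⟨h1, h2, by omega⟩
      · exact Or.inr ⟨h1, h2, by omega⟩
    · rintro (⟨h1, h2, -⟩ | ⟨h1, h2, -⟩) <;> exact ⟨h1, h2⟩
  · rw [Set.disjoint_left]
    rintro x ⟨-, -, h1⟩ ⟨-, -, h2⟩
    omega

theorem pellT_eq_sum {M : ℕ} (hk : 1 ≤ k) (hM : k < M) :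
    pellT (1 - 24 * (k : ℤ)) = -2 * ∑ z ∈ heckeIndex M k, (-1) ^ z.1 := by
  have h0 := pellCount_eq_card hk hM (Or.inl rfl : 0 = 0 ∨ 0 = 1)
  have h1 := pellCount_eq_card hk hM (Or.inr rfl : 1 = 0 ∨ 1 = 1)
  norm_num at h0 h1
  rw [pellT, h0, h1, ← Finset.sum_filter_add_sum_filter_not _ fun z => (z.1 + 1) % 2 = 0]
  have h2 : ∀ z ∈ (heckeIndex M k).filter (fun z => (z.1 + 1) % 2 = 0),
      (-1 : ℤ) ^ z.1 = -1 := by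
    intro z hz
    have h3 := (Finset.mem_filter.mp hz).2
    exact Odd.neg_one_pow (Nat.odd_iff.mpr (by omega))
  have h3 : ∀ z ∈ (heckeIndex M k).filter (fun z => ¬ (z.1 + 1) % 2 = 0),
      (-1 : ℤ) ^ z.1 = 1 := by
    intro z hz
    have h3 := (Finset.mem_filter.mp hz).2
    exact Even.neg_one_pow (Nat.even_iff.mpr (by omega))
  have h4 : (heckeIndex M k).filter (fun z => (z.1 + 1) % 2 = 1) =
      (heckeIndex M k).filter (fun z => ¬ (z.1 + 1) % 2 = 0) :=
    Finset.filter_congr fun z _ => by omega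
  rw [Finset.sum_congr rfl h2, Finset.sum_congr rfl h3, h4, Finset.sum_const, Finset.sum_const]
  push_cast
  simp only [nsmul_eq_mul]
  ring

end Count

/-! ### Generating functions of partitions by largest part -/

section Partitions

/-- The number of partitions of `n` with all parts at most `L`. -/
def partsLe (L n : ℕ) : ℕ :=
  (Finset.univ.filter fun π : n.Partition => ∀ i ∈ π.parts, i ≤ L).card

/-- Removing the parts `D` from a partition that contains them. -/
theorem card_filter_le_parts (L n : ℕ) (D : Multiset ℕ) (hpos : ∀ i ∈ D, 0 < i)
    (hle : ∀ i ∈ D, i ≤ L) :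
    (Finset.univ.filter fun π : n.Partition => D ≤ π.parts ∧ ∀ i ∈ π.parts, i ≤ L).card =
      if D.sum ≤ n then partsLe L (n - D.sum) else 0 := by
  split_ifs with h
  · refine Finset.card_bij'
      (fun π hπ => ⟨π.parts - D, fun {i} hi => π.parts_pos (Multiset.mem_of_le
        (Multiset.sub_le_self _ _) hi), ?_⟩)
      (fun σ _ => ⟨σ.parts + D, fun {i} hi => ?_, ?_⟩) ?_ ?_ ?_ ?_
    · have h1 := (Finset.mem_filter.mp hπ).2.1
      have h2 := congrArg Multiset.sum (Multiset.sub_add_cancel h1)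
      rw [Multiset.sum_add, π.parts_sum] at h2
      omega
    · rcases Multiset.mem_add.mp hi with hi | hi
      · exact σ.parts_pos hi
      · exact hpos i hi
    · rw [Multiset.sum_add, σ.parts_sum]
      omega
    · intro π hπ
      simp only [Finset.mem_filter, Finset.mem_univ, true_and] at hπ ⊢
      exact fun i hi => hπ.2 i (Multiset.mem_of_le (Multiset.sub_le_self _ _) hi)
    · intro σ hσ
      simp only [Finset.mem_filter, Finset.mem_univ, true_and] at hσ ⊢
      refine ⟨Multiset.le_add_left _ _, fun i hi => ?_⟩
      rcases Multiset.mem_add.mp hi with hi | hi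
      · exact hσ i hi
      · exact hle i hi
    · intro π hπ
      have h1 := (Finset.mem_filter.mp hπ).2.1
      exact Nat.Partition.ext (Multiset.sub_add_cancel h1)
    · intro σ _
      exact Nat.Partition.ext Multiset.add_sub_cancel_right
  · rw [Finset.card_eq_zero, Finset.filter_eq_empty_iff]
    rintro π - ⟨h1, -⟩
    have h2 := congrArg Multiset.sum (Multiset.sub_add_cancel h1)
    rw [Multiset.sum_add, π.parts_sum] at h2
    omega

/-- The generating function `1 / (q; q)_L` of the partitions with all parts at most `L`. -/
noncomputable def genLe (L : ℕ) : PowerSeries ℤ :=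
  PowerSeries.mk fun n => (partsLe L n : ℤ)

theorem coeff_X_pow_mul_genLe (L n : ℕ) (D : Multiset ℕ) (hpos : ∀ i ∈ D, 0 < i)
    (hle : ∀ i ∈ D, i ≤ L) :
    PowerSeries.coeff n (PowerSeries.X ^ D.sum * genLe L) =
      ((Finset.univ.filter fun π : n.Partition =>
        D ≤ π.parts ∧ ∀ i ∈ π.parts, i ≤ L).card : ℤ) := by
  rw [card_filter_le_parts L n D hpos hle, PowerSeries.coeff_X_pow_mul']
  split_ifs <;> simp [genLe]

theorem genLe_zero : genLe 0 = 1 := by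
  ext n
  rw [genLe, PowerSeries.coeff_mk, PowerSeries.coeff_one]
  split_ifs with h
  · subst h
    have : partsLe 0 0 = 1 := by
      rw [partsLe, Finset.filter_true_of_mem]
      · simp
      · intro π _ i hi
        exact (Multiset.le_sum_of_mem hi).trans (le_of_eq π.parts_sum)
    rw [this]; rfl
  · have : partsLe 0 n = 0 := by
      rw [partsLe, Finset.card_eq_zero, Finset.filter_eq_empty_iff]
      intro π _ h1
      have h2 : π.parts = 0 := Multiset.eq_zero_of_forall_notMem fun i hi =>
        absurd (π.parts_pos hi) (not_lt.mpr (h1 i hi))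
      have h3 := π.parts_sum
      rw [h2] at h3
      exact h h3.symm
    rw [this]; rfl

theorem genLe_eq (L : ℕ) :
    genLe L = (1 - PowerSeries.X ^ (L + 1)) * genLe (L + 1) := by
  have key : genLe (L + 1) = genLe L + PowerSeries.X ^ (L + 1) * genLe (L + 1) := by
    ext n
    have h1 := coeff_X_pow_mul_genLe (L + 1) n {L + 1} (by simp) (by simp)
    rw [Multiset.sum_singleton] at h1
    rw [map_add, h1, genLe, genLe, PowerSeries.coeff_mk, PowerSeries.coeff_mk, partsLe, partsLe,
      ← Nat.cast_add, ← Finset.card_union_of_disjoint]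
    · congr 2
      ext π
      simp only [Finset.mem_filter, Finset.mem_univ, true_and, Finset.mem_union,
        Multiset.singleton_le]
      constructor
      · intro h
        by_cases hL : L + 1 ∈ π.parts
        · exact Or.inr ⟨hL, h⟩
        · refine Or.inl fun i hi => ?_
          have h2 : i ≠ L + 1 := fun h3 => hL (h3 ▸ hi)
          have h4 := h i hi
          omega
      · rintro (h | h)
        · exact fun i hi => (h i hi).trans (Nat.le_succ L)
        · exact h.2
    · rw [Finset.disjoint_filter]
      rintro π - h1 ⟨h2, -⟩
      have h3 := h1 _ (Multiset.singleton_le.mp h2)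
      omega
  linear_combination -key

theorem le_largestPart {n : ℕ} {π : n.Partition} {i : ℕ} (hi : i ∈ π.parts) :
    i ≤ largestPart π :=
  Finset.le_sup (f := id) (Multiset.mem_toFinset.mpr hi)

theorem largestPart_le_iff {n : ℕ} {π : n.Partition} {L : ℕ} :
    largestPart π ≤ L ↔ ∀ i ∈ π.parts, i ≤ L := by
  simp [largestPart]

theorem largestPart_mem {n : ℕ} {π : n.Partition} (h : 0 < largestPart π) :
    largestPart π ∈ π.parts := by
  have hne : π.parts.toFinset.Nonempty := by
    rw [Finset.nonempty_iff_ne_empty]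
    intro h1
    rw [largestPart, h1] at h
    simp at h
  obtain ⟨j, hj, hj2⟩ := Finset.exists_mem_eq_sup _ hne (id : ℕ → ℕ)
  have h3 : largestPart π = j := hj2
  rw [h3]
  exact Multiset.mem_toFinset.mp hj

theorem largestPart_lt {n N : ℕ} (hN : n < N) (π : n.Partition) : largestPart π < N := by
  refine lt_of_le_of_lt (largestPart_le_iff.mpr fun i hi => ?_) hN
  exact (Multiset.le_sum_of_mem hi).trans (le_of_eq π.parts_sum)

theorem largestPart_eq_iff {n : ℕ} {π : n.Partition} {L : ℕ} :
    largestPart π = L ↔ (L = 0 ∨ L ∈ π.parts) ∧ ∀ i ∈ π.parts, i ≤ L := by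
  constructor
  · rintro rfl
    refine ⟨?_, fun i hi => le_largestPart hi⟩
    rcases Nat.eq_zero_or_pos (largestPart π) with h | h
    · exact Or.inl h
    · exact Or.inr (largestPart_mem h)
  · rintro ⟨h1, h2⟩
    refine le_antisymm (largestPart_le_iff.mpr h2) ?_
    rcases h1 with rfl | h1
    · exact Nat.zero_le _
    · exact le_largestPart h1

/-- The generating function of the partitions with largest part `L`. -/
theorem card_largestPart_eq (L n : ℕ) :
    ((Finset.univ.filter fun π : n.Partition => largestPart π = L).card : ℤ) =
      PowerSeries.coeff n (PowerSeries.X ^ L * genLe L) := by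
  rcases Nat.eq_zero_or_pos L with rfl | hL
  · have h := coeff_X_pow_mul_genLe 0 n 0 (by simp) (by simp)
    rw [Multiset.sum_zero] at h
    rw [h]
    congr 2
    ext π
    simp [largestPart_eq_iff]
  · have h := coeff_X_pow_mul_genLe L n {L} (by simpa using hL) (by simp)
    rw [Multiset.sum_singleton] at h
    rw [h]
    congr 2
    ext π
    simp [largestPart_eq_iff, hL.ne']

/-- The generating function of the partitions with largest part `L` in which `a + 1, …, L` are
parts. -/
theorem card_run (L n a : ℕ) (ha : a < L) :
    ((Finset.univ.filter fun π : n.Partition =>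
      largestPart π = L ∧ ∀ i ∈ Finset.Ioc a L, i ∈ π.parts).card : ℤ) =
      PowerSeries.coeff n (PowerSeries.X ^ (∑ i ∈ Finset.Ioc a L, i) * genLe L) := by
  have h := coeff_X_pow_mul_genLe L n (Finset.Ioc a L).val
    (fun i hi => by
      have := Finset.mem_Ioc.mp (Finset.mem_val.mp hi)
      omega)
    (fun i hi => (Finset.mem_Ioc.mp (Finset.mem_val.mp hi)).2)
  rw [Finset.sum_val] at h
  simp only [id_eq] at h
  rw [h]
  congr 2
  ext π
  simp only [Finset.mem_filter, Finset.mem_univ, true_and, largestPart_eq_iff,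
    Multiset.le_iff_subset (Finset.Ioc a L).nodup]
  constructor
  · rintro ⟨⟨-, h2⟩, h3⟩
    exact ⟨fun i hi => h3 i hi, h2⟩
  · rintro ⟨h1, h2⟩
    exact ⟨⟨Or.inr (h1 (Finset.mem_val.mpr (Finset.mem_Ioc.mpr ⟨ha, le_refl L⟩))), h2⟩,
      fun i hi => h1 hi⟩

/-- The numbers `a` below the largest part `L` for which `a + 1, …, L` are all parts are those from
`maex π` on. -/
theorem maex_add_card_run {n : ℕ} (hn : 1 ≤ n) (π : n.Partition) :
    maex π + ((Finset.range (largestPart π)).filter fun a =>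
      ∀ i ∈ Finset.Ioc a (largestPart π), i ∈ π.parts).card = largestPart π := by
  obtain ⟨⟨h1, h2⟩, h3⟩ := isGreatest_maex hn π
  have h4 : ((Finset.range (largestPart π)).filter fun a =>
      ∀ i ∈ Finset.Ioc a (largestPart π), i ∈ π.parts) =
      Finset.Ico (maex π) (largestPart π) := by
    ext a
    simp only [Finset.mem_filter, Finset.mem_range, Finset.mem_Ioc, Finset.mem_Ico]
    constructor
    · rintro ⟨ha, h⟩
      refine ⟨?_, ha⟩
      by_contra h5
      exact h2 (h _ ⟨not_le.mp h5, h1.le⟩)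
    · rintro ⟨h5, ha⟩
      refine ⟨ha, fun i hi => ?_⟩
      rcases hi.2.lt_or_eq with h6 | rfl
      · by_contra h7
        have h8 : i ≤ maex π := h3 ⟨h6, h7⟩
        omega
      · exact largestPart_mem (by omega)
  rw [h4, Nat.card_Ico]
  omega

theorem numPartitions_eq_coeff {n N : ℕ} (hN : n < N) :
    (numPartitions n : ℤ) =
      PowerSeries.coeff n (∑ L ∈ Finset.range N, PowerSeries.X ^ L * genLe L) := by
  rw [map_sum, numPartitions, ← Finset.card_univ,
    Finset.card_eq_sum_card_fiberwise (f := largestPart) (t := Finset.range N)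
      (fun π _ => by simpa using largestPart_lt hN π), Nat.cast_sum]
  exact Finset.sum_congr rfl fun L _ => card_largestPart_eq L n

/-- The generating function of the lengths `L - maex` of the runs at the top, for partitions with
largest part `L`, multiplied by `(q; q)_L`. -/
noncomputable def runGen (L : ℕ) : PowerSeries ℤ :=
  ∑ a ∈ Finset.range L, PowerSeries.X ^ (∑ i ∈ Finset.Ioc a L, i)

theorem runGen_succ (L : ℕ) :
    runGen (L + 1) = PowerSeries.X ^ (L + 1) * (runGen L + 1) := by
  have h : ∀ a ≤ L, ∑ i ∈ Finset.Ioc a (L + 1), i = (L + 1) + ∑ i ∈ Finset.Ioc a L, i := by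
    intro a ha
    rw [Finset.sum_Ioc_succ_top ha, add_comm]
  rw [runGen, Finset.sum_range_succ, h L le_rfl, runGen, mul_add, Finset.mul_sum]
  congr 1
  · refine Finset.sum_congr rfl fun a ha => ?_
    rw [h a (Finset.mem_range.mp ha).le, pow_add]
  · simp

theorem sigmaMaex_eq_coeff {n N : ℕ} (hn : 1 ≤ n) (hN : n < N) :
    (sigmaMaex n : ℤ) = PowerSeries.coeff n
      (∑ L ∈ Finset.range N, (L : PowerSeries ℤ) * PowerSeries.X ^ L * genLe L -
        ∑ L ∈ Finset.range N, runGen L * genLe L) := by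
  have hmaps : ∀ π ∈ (Finset.univ : Finset n.Partition), largestPart π ∈ Finset.range N :=
    fun π _ => Finset.mem_range.mpr (largestPart_lt hN π)
  have h1 : ∑ π : n.Partition, (largestPart π : ℤ) = PowerSeries.coeff n
      (∑ L ∈ Finset.range N, (L : PowerSeries ℤ) * PowerSeries.X ^ L * genLe L) := by
    rw [← Finset.sum_fiberwise_of_maps_to hmaps, map_sum]
    refine Finset.sum_congr rfl fun L _ => ?_
    rw [Finset.sum_congr rfl (g := fun _ => (L : ℤ))
      (fun π hπ => by rw [(Finset.mem_filter.mp hπ).2]), Finset.sum_const, nsmul_eq_mul,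
      card_largestPart_eq, mul_assoc, ← map_natCast (PowerSeries.C (R := ℤ)) L,
      PowerSeries.coeff_C_mul, mul_comm]
  have h2 : ∑ π : n.Partition, (((Finset.range (largestPart π)).filter fun a =>
      ∀ i ∈ Finset.Ioc a (largestPart π), i ∈ π.parts).card : ℤ) = PowerSeries.coeff n
      (∑ L ∈ Finset.range N, runGen L * genLe L) := by
    rw [← Finset.sum_fiberwise_of_maps_to hmaps, map_sum]
    refine Finset.sum_congr rfl fun L _ => ?_
    rw [runGen, Finset.sum_mul, map_sum, Finset.sum_congr rfl (g := fun π : n.Partition =>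
      ∑ a ∈ Finset.range L, if ∀ i ∈ Finset.Ioc a L, i ∈ π.parts then (1 : ℤ) else 0)
      (fun π hπ => by
        rw [(Finset.mem_filter.mp hπ).2, Finset.card_filter, Nat.cast_sum]
        exact Finset.sum_congr rfl fun a _ => by split_ifs <;> rfl), Finset.sum_comm]
    refine Finset.sum_congr rfl fun a ha => ?_
    rw [← card_run L n a (Finset.mem_range.mp ha), ← Finset.filter_filter, Finset.card_filter,
      Nat.cast_sum]
    exact Finset.sum_congr rfl fun π _ => by split_ifs <;> rfl
  rw [map_sub, ← h1, ← h2, ← Finset.sum_sub_distrib, sigmaMaex, Nat.cast_sum]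
  refine Finset.sum_congr rfl fun π _ => ?_
  have h3 := maex_add_card_run hn π
  omega

end Partitions

/-! ### The identity of generating functions -/

section Assembly

open PowerSeries in
/-- The double sum collects the triples in `heckeIndex` by their exponent. -/
theorem coeff_hecke_sum {M k : ℕ} :
    coeff k (∑ r ∈ Finset.range M, (-1) ^ r *
      ((X : ℤ⟦X⟧) ^ (r * (r + 1)) + X ^ ((r + 1) * (r + 2))) * heckeInner X (r + 1)) =
      ∑ z ∈ heckeIndex M k, (-1) ^ z.1 := by
  have hterm : ∀ r j : ℕ, j < 2 * (r + 1) → ∀ c : ℕ,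
      (coeff k ((X : ℤ⟦X⟧) ^ c * X ^ (2 * (r + 1) ^ 2 - j * (j + 1) / 2)) : ℤ) =
        if c + 2 * (r + 1) ^ 2 = k + j * (j + 1) / 2 then 1 else 0 := by
    intro r j hj c
    have h1 := triangle_lt hj
    rw [← pow_add, coeff_X_pow]
    exact if_congr (by omega) rfl rfl
  have h1 : ∀ r ∈ Finset.range M, coeff k ((-1) ^ r *
      ((X : ℤ⟦X⟧) ^ (r * (r + 1)) + X ^ ((r + 1) * (r + 2))) * heckeInner X (r + 1)) =
      ∑ j ∈ Finset.range (2 * M), ∑ b : Bool, if j < 2 * (r + 1) ∧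
        (bif b then (r + 1) * (r + 2) else r * (r + 1)) + 2 * (r + 1) ^ 2 =
          k + j * (j + 1) / 2 then (-1) ^ r else (0 : ℤ) := by
    intro r hr
    have h2 : Finset.range (2 * (r + 1)) ⊆ Finset.range (2 * M) :=
      Finset.range_subset_range.mpr (by have := Finset.mem_range.mp hr; omega)
    rw [← Finset.sum_subset h2]
    · have h3 : ((-1 : ℤ⟦X⟧) ^ r) = C ((-1 : ℤ) ^ r) := by simp
      rw [h3, mul_assoc, coeff_C_mul, heckeInner, Finset.mul_sum, map_sum, Finset.mul_sum]
      refine Finset.sum_congr rfl fun j hj => ?_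
      have hj' := Finset.mem_range.mp hj
      rw [add_mul, map_add, hterm r j hj', hterm r j hj', Fintype.sum_bool]
      simp only [hj', true_and, cond_true, cond_false]
      split_ifs <;> ring
    · intro j _ hj
      refine Finset.sum_eq_zero fun b _ => if_neg fun h => hj (Finset.mem_range.mpr h.1)
  rw [map_sum, Finset.sum_congr rfl h1, heckeIndex, Finset.sum_filter, Finset.sum_product]
  refine Finset.sum_congr rfl fun r _ => ?_
  rw [Finset.sum_product]

theorem heckeIndex_zero (M : ℕ) : heckeIndex M 0 = ∅ := by
  rw [heckeIndex, Finset.filter_eq_empty_iff]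
  rintro ⟨r, j, b⟩ - ⟨h1, h2⟩
  have h3 := triangle_lt h1
  simp only at h2 h3
  omega

open PowerSeries in
/-- The Lambert series `∑ q ^ i / (1 - q ^ i)`, truncated, has the divisor function as
coefficients. -/
theorem coeff_lambert {M k : ℕ} (hk : 1 ≤ k) (hM : k < M) :
    coeff k (∑ i ∈ Finset.range M, (X : ℤ⟦X⟧) ^ (i + 1) *
      ∑ j ∈ Finset.range M, X ^ ((i + 1) * j)) = (k.divisors.card : ℤ) := by
  have h1 : ∀ i ∈ Finset.range M, coeff k ((X : ℤ⟦X⟧) ^ (i + 1) *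
      ∑ j ∈ Finset.range M, X ^ ((i + 1) * j)) = if (i + 1) ∣ k then (1 : ℤ) else 0 := by
    intro i _
    have h2 : ∀ j ∈ Finset.range M, coeff k ((X : ℤ⟦X⟧) ^ (i + 1) * X ^ ((i + 1) * j)) =
        if j = k / (i + 1) - 1 ∧ (i + 1) ∣ k then (1 : ℤ) else 0 := by
      intro j _
      rw [← pow_add, coeff_X_pow]
      refine if_congr ?_ rfl rfl
      constructor
      · intro h
        have h3 : k = (i + 1) * (j + 1) := by rw [h]; ring
        refine ⟨?_, ⟨j + 1, h3⟩⟩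
        rw [h3, Nat.mul_div_cancel_left _ (Nat.succ_pos i), Nat.add_sub_cancel]
      · rintro ⟨rfl, t, rfl⟩
        rw [Nat.mul_div_cancel_left _ (Nat.succ_pos i)]
        have ht : 1 ≤ t := Nat.pos_of_ne_zero (by rintro rfl; simp at hk)
        obtain ⟨t, rfl⟩ := Nat.exists_eq_add_of_le ht
        rw [Nat.add_sub_cancel_left]; ring
    rw [Finset.mul_sum, map_sum, Finset.sum_congr rfl h2]
    by_cases hd : (i + 1) ∣ k
    · simp only [hd, and_true, if_true]
      rw [Finset.sum_ite_eq' , if_pos]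
      rw [Finset.mem_range]
      have := Nat.div_le_self k (i + 1)
      omega
    · simp [hd]
  rw [map_sum, Finset.sum_congr rfl h1, ← Finset.sum_filter, Finset.sum_const, nsmul_eq_mul,
    mul_one]
  congr 1
  refine Finset.card_bij (fun i _ => i + 1) ?_ ?_ ?_
  · intro i hi
    exact Nat.mem_divisors.mpr ⟨(Finset.mem_filter.mp hi).2, by omega⟩
  · intro i _ j _ h
    exact Nat.succ_injective h
  · intro d hd
    have h2 := Nat.divisor_le hd
    have h3 := Nat.pos_of_mem_divisors hd
    refine ⟨d - 1, ?_, by omega⟩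
    rw [Finset.mem_filter, Finset.mem_range, Nat.sub_add_cancel h3]
    exact ⟨by omega, Nat.dvd_of_mem_divisors hd⟩

/-- If `q` is nilpotent, the elements `1 / (q; q)_n` exist. -/
theorem exists_inv_poch {A : Type*} [CommRing A] {q : A} (hq : IsNilpotent q) :
    ∃ e : ℕ → A, e 0 = 1 ∧ ∀ n, e n = (1 - q ^ (n + 1)) * e (n + 1) := by
  have hu : ∀ n, IsUnit (1 - q ^ (n + 1)) := fun n =>
    (hq.pow_succ n).isUnit_one_sub
  refine ⟨fun n => ∏ i ∈ Finset.range n, ((hu i).unit⁻¹ : Aˣ), by simp, fun n => ?_⟩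
  simp only
  rw [Finset.prod_range_succ, mul_comm, mul_assoc, IsUnit.val_inv_mul, mul_one]

open PowerSeries in
/-- The identity of generating functions, modulo a power of `X`. In the quotient by `X ^ M` the
variable is nilpotent, so that all the sums are finite. -/
theorem X_pow_dvd_genFun_sub (M : ℕ) :
    (X : ℤ⟦X⟧) ^ M ∣ (∑ L ∈ Finset.range M, (L : ℤ⟦X⟧) * X ^ L * genLe L -
        ∑ L ∈ Finset.range M, runGen L * genLe L) -
      (∑ L ∈ Finset.range M, X ^ L * genLe L) *
        (∑ i ∈ Finset.range M, X ^ (i + 1) * ∑ j ∈ Finset.range M, X ^ ((i + 1) * j) -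
          ∑ r ∈ Finset.range M, (-1) ^ r * (X ^ (r * (r + 1)) + X ^ ((r + 1) * (r + 2))) *
            heckeInner X (r + 1)) := by
  rw [← Ideal.mem_span_singleton, ← Ideal.Quotient.eq_zero_iff_mem]
  set φ := Ideal.Quotient.mk (Ideal.span {(X : ℤ⟦X⟧) ^ M}) with hφ
  have hq : φ X ^ M = 0 := by
    rw [← map_pow]
    exact Ideal.Quotient.eq_zero_iff_mem.mpr (Ideal.mem_span_singleton_self _)
  have he0 : φ (genLe 0) = 1 := by rw [genLe_zero, map_one]
  have he : ∀ n, φ (genLe n) = (1 - φ X ^ (n + 1)) * φ (genLe (n + 1)) := by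
    intro n
    rw [← map_pow, ← map_one φ, ← map_sub, ← map_mul, ← genLe_eq]
  have hw : ∀ i, (∑ j ∈ Finset.range M, φ X ^ ((i + 1) * j)) * (1 - φ X ^ (i + 1)) = 1 := by
    intro i
    simp only [pow_mul]
    rw [geom_sum_mul_neg, ← pow_mul,
      pow_eq_zero_of_le (Nat.le_mul_of_pos_left M (Nat.succ_pos i)) hq, sub_zero]
  have hnil : IsNilpotent (φ X) := ⟨M, hq⟩
  obtain ⟨e, hE0, hE⟩ := exists_inv_poch (q := φ X ^ 2) (hnil.pow_succ 1)
  obtain ⟨f, hf0, hf⟩ := exists_inv_poch hnil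
  have h1 := sum_natCast_mul_eq hq he0 he hw
  have h2 := sum_run_mul_eq hq he (B := fun L => φ (runGen L)) (by simp [runGen])
    (fun L => by simp [runGen_succ])
  have h3 := sum_evenPoch_eq_hecke hq hE0 hE hf0 hf (fun n => (hnil.pow_succ n).isUnit_one_sub)
    (S := heckeInner (φ X)) (by simp [heckeInner]) heckeInner_succ
  have h4 : ∀ r, φ (heckeInner X r) = heckeInner (φ X) r := fun r => by
    simp [heckeInner]
  rw [h3] at h2
  simp only [map_sub, map_add, map_mul, map_sum, map_pow, map_natCast, map_neg, map_one, h4]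
  rw [h1, h2]
  simp only [eulerSum, one_mul]
  ring

end Assembly

theorem mainTheorem3 (n : ℕ) (hn : 1 ≤ n) :
    (sigmaMaex n : ℚ) =
      ∑ k ∈ Finset.Icc 1 n, (numPartitions (n - k) : ℚ) *
        ((k.divisors.card : ℚ) + (1 / 2 : ℚ) * (pellT (1 - 24 * (k : ℤ)) : ℚ)) := by
  have h1 := PowerSeries.X_pow_dvd_iff.mp (X_pow_dvd_genFun_sub (n + 1)) n (Nat.lt_succ_self n)
  rw [map_sub, sub_eq_zero, ← sigmaMaex_eq_coeff hn (Nat.lt_succ_self n), mul_comm,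
    PowerSeries.coeff_mul, Finset.Nat.sum_antidiagonal_eq_sum_range_succ_mk,
    Finset.sum_range_succ'] at h1
  have h2 : (sigmaMaex n : ℤ) = ∑ k ∈ Finset.range n, (numPartitions (n - (k + 1)) : ℤ) *
      (((k + 1).divisors.card : ℤ) - ∑ z ∈ heckeIndex (n + 1) (k + 1), (-1) ^ z.1) := by
    rw [h1]
    have h0 : PowerSeries.coeff 0 (∑ i ∈ Finset.range (n + 1), (PowerSeries.X : PowerSeries ℤ) ^
        (i + 1) * ∑ j ∈ Finset.range (n + 1), PowerSeries.X ^ ((i + 1) * j) -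
        ∑ r ∈ Finset.range (n + 1), (-1) ^ r * (PowerSeries.X ^ (r * (r + 1)) +
          PowerSeries.X ^ ((r + 1) * (r + 2))) * heckeInner PowerSeries.X (r + 1)) = 0 := by
      rw [map_sub, coeff_hecke_sum, heckeIndex_zero, Finset.sum_empty]
      simp
    rw [h0, zero_mul, add_zero]
    refine Finset.sum_congr rfl fun k hk => ?_
    have hk' := Finset.mem_range.mp hk
    rw [map_sub, coeff_lambert (Nat.le_add_left 1 k) (by omega), coeff_hecke_sum,
      ← numPartitions_eq_coeff (show n - (k + 1) < n + 1 by omega), mul_comm]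
  have h3 : (sigmaMaex n : ℚ) = ((sigmaMaex n : ℤ) : ℚ) := by norm_cast
  rw [h3, h2, ← Finset.Ico_add_one_right_eq_Icc, Finset.sum_Ico_eq_sum_range, Nat.add_sub_cancel,
    Int.cast_sum]
  refine Finset.sum_congr rfl fun k hk => ?_
  have hk' := Finset.mem_range.mp hk
  rw [add_comm 1 k, pellT_eq_sum (Nat.le_add_left 1 k) (show k + 1 < n + 1 by omega)]
  push_cast
  ring
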